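/- **Notation.** For a real $d\times m$ matrix $B$ let $\|B\|_2$ be its operator norm for the Euclidean norms, $\sigma_{\max}(B)=\sigma_1\ge\cdots\ge\sigma_{\min(d,m)}=\sigma_{\min}(B)$ its singular values, and $\kappa(B)=\sigma_{\max}(B)/\sigma_{\min}(B)$. **Algorithm SPA**, on a real $n\times m$ matrix $B$ and a positive integer $r$. Start with $S=B$ and $\mathcal I=\emptyset$. While $|\mathcal I|<r$: choose an index $i^*$ for which the column $t=s_{i^*}$ of $S$ has maximal Euclidean norm, replace $S$ by $\bigl(I-tt^\top/\|t\|_2^2\bigr)S$ and $\mathcal I$ by $\mathcal I\cup\{i^*\}$. Output $\mathcal I$. **Preconditioned SPA**, on a real $d\times m$ matrix $B$ and a positive integer $r\le\min(d,m)$. 1. Take a singular value decomposition $B=U\Sigma V^\top$ ($U,V$ orthogonal, singular values $\sigma_1\ge\sigma_2\ge\cdots$), and put $P=\mathrm{diag}(\sigma_1,\dots,\sigma_r)(v_1,\dots,v_r)^\top\in\mathbb R^{r\times m}$, where $v_1,\dots,v_r$ are the first $r$ columns of $V$. 2. Let $L^*$ be an optimal solution of the problem: minimize $-\log\det L$ over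 all symmetric positive definite $L\in\mathbb R^{r\times r}$ with $p_i^\top Lp_i\le 1$ for every column $p_i$ of $P$. 3. Run SPA on $((L^*)^{1/2}P,\,r)$ and output the resulting index set. **Theorem.** Let $r\ge 2$, $A,N\in\mathbb R^{d\times m}$ and $\widetilde A=A+N$. Suppose that $A=F(I,K)\Pi$, where $F\in\mathbb R^{d\times r}$ has rank $r$, $I$ is the $r\times r$ identity matrix, $K\in\mathbb R^{r\times(m-r)}$ is entrywise nonnegative with all column sums at most $1$, and $\Pi$ is an $m\times m$ permutation matrix. Let $\varepsilon=\|N\|_2$ and suppose that $$\varepsilon\le\frac{\sigma_{\min}(F)}{1225\sqrt r}.$$ Then preconditioned SPA on the input $(\widetilde A,r)$ always terminates (all its steps can be carried out, in particular no division by zero occurs), whatever singular value decomposition is used and however ties between columns of maximal norm are broken; and every index set $\mathcal I$ that it returns has exactly $r$ elements, which can be ordered as $\mathcal I(1),\dots,\mathcal I(r)$ so that $$\|\widetilde a_{\mathcal I(j)}-f_j\|_2\le(432\,\kappa(F)+4)\,\varepsilon\qquad(j=1,\dots,r),$$ where $\widetilde a_i$ and $f_j$ denote the columns of $\widetilde A$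 and $F$. -/

import Mathlib

namespace PrecondSPA

open Matrix

noncomputable section

/-- The matrix 2-norm, i.e. the operator norm for the Euclidean norms. -/
def norm2 {d m : ℕ} (N : Matrix (Fin d) (Fin m) ℝ) : ℝ :=
  ‖LinearMap.toContinuousLinearMap (Matrix.toEuclideanLin N)‖

/-- The Euclidean norm of a column vector. -/
def vecNorm2 {d : ℕ} (v : Fin d → ℝ) : ℝ := ‖(WithLp.toLp 2 v : EuclideanSpace ℝ (Fin d))‖

/-- The largest singular value `σ₁`. (Mathlib's list of singular values is in descending order
and indexed from `0`.) -/
def sigmaMax {d m : ℕ} (A : Matrix (Fin d) (Fin m) ℝ) : ℝ :=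
  (Matrix.toEuclideanLin A).singularValues 0

/-- The smallest of the singular values `σ₁ ≥ ⋯ ≥ σ_t`, `t = min d m`. -/
def sigmaMin {d m : ℕ} (A : Matrix (Fin d) (Fin m) ℝ) : ℝ :=
  (Matrix.toEuclideanLin A).singularValues (min d m - 1)

/-- The condition number `κ(A) = σ_max(A) / σ_min(A)`. -/
def cond {d m : ℕ} (A : Matrix (Fin d) (Fin m) ℝ) : ℝ := sigmaMax A / sigmaMin A

/-- The `r × m` matrix `(I, K)`. -/
def identityBeside {r m : ℕ} (hrm : r ≤ m) (K : Matrix (Fin r) (Fin (m - r)) ℝ) :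
    Matrix (Fin r) (Fin m) ℝ :=
  (Matrix.fromCols (1 : Matrix (Fin r) (Fin r) ℝ) K).submatrix id
    (finSumFinEquiv.trans (finCongr (Nat.add_sub_cancel' hrm))).symm

/-- `A = F (I, K) Π` with `K` nonnegative and `Π` a permutation matrix, where `F` has rank `r` and
the column sums of `K` are at most one. -/
def IsSeparable {d m r : ℕ} (A : Matrix (Fin d) (Fin m) ℝ) (F : Matrix (Fin d) (Fin r) ℝ) : Prop :=
  ∃ (hrm : r ≤ m) (K : Matrix (Fin r) (Fin (m - r)) ℝ) (π : Equiv.Perm (Fin m)),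
    A = F * (identityBeside hrm K * π.permMatrix ℝ) ∧
    (∀ i j, 0 ≤ K i j) ∧
    F.rank = r ∧
    ∀ j, ∑ i, K i j ≤ 1

/-! ### The successive projection algorithm (SPA) -/

/-- A state of SPA: the current matrix `S` and the current index set. -/
structure SPAState (n m : ℕ) where
  S : Matrix (Fin n) (Fin m) ℝ
  I : Finset (Fin m)

/-- One pass through the loop of SPA, which is entered only when fewer than `r` indices have been
found. Any column `t` of `S` of maximal norm may be selected. There is no successor if `t = 0`, as
then the projection `1 - t tᵀ / ‖t‖²` is undefined. -/
def SPAStep {n m : ℕ} (r : ℕ) (s s' : SPAState n m) : Prop :=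
  s.I.card < r ∧
  ∃ i : Fin m,
    (∀ k, s.S.col k ⬝ᵥ s.S.col k ≤ s.S.col i ⬝ᵥ s.S.col i) ∧
    s.S.col i ≠ 0 ∧
    s'.S = (1 - (s.S.col i ⬝ᵥ s.S.col i)⁻¹ • vecMulVec (s.S.col i) (s.S.col i)) * s.S ∧
    s'.I = insert i s.I

/-- The states that a run of SPA on the input `(A, r)` can reach. -/
def SPAReaches {n m : ℕ} (A : Matrix (Fin n) (Fin m) ℝ) (r : ℕ) (s : SPAState n m) : Prop :=
  Relation.ReflTransGen (SPAStep r) ⟨A, ∅⟩ s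

/-- Some run of SPA on `(A, r)` stops regularly with the output `I`. -/
def SPAReturns {n m : ℕ} (A : Matrix (Fin n) (Fin m) ℝ) (r : ℕ) (I : Finset (Fin m)) : Prop :=
  ∃ S, SPAReaches A r ⟨S, I⟩ ∧ r ≤ I.card

/-- Every run of SPA on `(A, r)`, whatever the choice among columns of equal norm, stops regularly:
no run is infinite, and none gets stuck before `r` indices have been found. -/
def SPATerminates {n m : ℕ} (A : Matrix (Fin n) (Fin m) ℝ) (r : ℕ) : Prop :=
  (¬ ∃ run : ℕ → SPAState n m, run 0 = ⟨A, ∅⟩ ∧ ∀ k, SPAStep r (run k) (run (k + 1))) ∧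
  ∀ s, SPAReaches A r s → s.I.card < r → ∃ s', SPAStep r s s'

/-! ### The preconditioned SPA -/

/-- The `d × m` diagonal matrix with diagonal entries `σ`. -/
def rectDiagonal {d m : ℕ} (σ : Fin (min d m) → ℝ) : Matrix (Fin d) (Fin m) ℝ :=
  Matrix.of fun i j =>
    if h : (i : ℕ) = j then σ ⟨i, lt_min i.isLt (h ▸ j.isLt)⟩ else 0

/-- `A = U Σ Vᵀ` is a singular value decomposition with singular values in descending order. -/
def IsSVD {d m : ℕ} (A : Matrix (Fin d) (Fin m) ℝ) (U : Matrix (Fin d) (Fin d) ℝ)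
    (σ : Fin (min d m) → ℝ) (V : Matrix (Fin m) (Fin m) ℝ) : Prop :=
  U ∈ Matrix.orthogonalGroup (Fin d) ℝ ∧ V ∈ Matrix.orthogonalGroup (Fin m) ℝ ∧
  (∀ k, 0 ≤ σ k) ∧ Antitone σ ∧ A = U * rectDiagonal σ * Vᵀ

/-- `P = diag(σ₁, …, σ_r) (v₁, …, v_r)ᵀ` for some singular value decomposition of `A`. -/
def IsTruncatedSVD {d m : ℕ} (A : Matrix (Fin d) (Fin m) ℝ) (r : ℕ)
    (P : Matrix (Fin r) (Fin m) ℝ) : Prop :=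
  ∃ (U : Matrix (Fin d) (Fin d) ℝ) (σ : Fin (min d m) → ℝ) (V : Matrix (Fin m) (Fin m) ℝ)
    (hr : r ≤ min d m),
    IsSVD A U σ V ∧
    P = Matrix.diagonal (fun k : Fin r => σ (Fin.castLE hr k)) *
      (V.submatrix id (Fin.castLE (hr.trans (min_le_right d m))))ᵀ

/-- `L` is feasible for the problem of the origin-centred minimum volume enclosing ellipsoid of the
set `𝒮`. -/
def MVEEFeasible {n : ℕ} (𝒮 : Set (Fin n → ℝ)) (L : Matrix (Fin n) (Fin n) ℝ) : Prop :=
  L.PosDef ∧ ∀ a ∈ 𝒮, a ⬝ᵥ (L *ᵥ a) ≤ 1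

/-- `L` minimizes `-log det` over the feasible matrices. -/
def MVEEOptimal {n : ℕ} (𝒮 : Set (Fin n → ℝ)) (L : Matrix (Fin n) (Fin n) ℝ) : Prop :=
  MVEEFeasible 𝒮 L ∧ ∀ L', MVEEFeasible 𝒮 L' → -Real.log L.det ≤ -Real.log L'.det

/-- The square root `U diag(λ₁^{1/2}, …, λ_n^{1/2}) Uᵀ` of `L = U diag(λ₁, …, λ_n) Uᵀ`. -/
def sqrtMatrix {n : ℕ} (L : Matrix (Fin n) (Fin n) ℝ) (hL : L.PosDef) :
    Matrix (Fin n) (Fin n) ℝ :=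
  (hL.isHermitian.eigenvectorUnitary : Matrix (Fin n) (Fin n) ℝ) *
    Matrix.diagonal (fun i => √(hL.isHermitian.eigenvalues i)) *
    (hL.isHermitian.eigenvectorUnitary : Matrix (Fin n) (Fin n) ℝ)ᵀ

/-- Some run of the preconditioned SPA on `(A, r)` stops regularly with the output `I`. -/
def Returns {d m : ℕ} (A : Matrix (Fin d) (Fin m) ℝ) (r : ℕ) (I : Finset (Fin m)) : Prop :=
  ∃ P : Matrix (Fin r) (Fin m) ℝ, IsTruncatedSVD A r P ∧
    ∃ (L : Matrix (Fin r) (Fin r) ℝ) (hL : MVEEOptimal (Set.range P.col) L),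
      SPAReturns (sqrtMatrix L hL.1.1 * P) r I

/-- Every run of the preconditioned SPA on `(A, r)` stops regularly: step 1 can be carried out;
whatever singular value decomposition is used in it, the optimization problem of step 2 is
solvable; and with every solution of it, every run of SPA in step 3 stops regularly. -/
def Terminates {d m : ℕ} (A : Matrix (Fin d) (Fin m) ℝ) (r : ℕ) : Prop :=
  (∃ P : Matrix (Fin r) (Fin m) ℝ, IsTruncatedSVD A r P) ∧
  ∀ P : Matrix (Fin r) (Fin m) ℝ, IsTruncatedSVD A r P →
    (∃ L, MVEEOptimal (Set.range P.col) L) ∧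
    ∀ (L : Matrix (Fin r) (Fin r) ℝ) (hL : MVEEOptimal (Set.range P.col) L),
      SPATerminates (sqrtMatrix L hL.1.1 * P) r

end

end PrecondSPA

/-! Write Ã = FW + N, where the columns of W are nonnegative with sums at most 1 and r of them are
the unit vectors. Preconditioning makes the vertices (the images of the columns of F) well
conditioned with absolute constants, so SPA itself never sees κ(F).

Reduction: step 1 yields P = RᵀÃ, with R the first r left singular vectors. Since FW has rank at
most r, the (r+1)-st singular value of Ã is at most ε, so the range of R captures Ã up to ε and F up
to 3ε. Hence G = RᵀF satisfies ‖Gx‖ ≥ (σ_min(F) − 3ε)‖x‖, and P = GW + RᵀN with noise of size η ≈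
ε/σ_min(F) relative to G (`exists_reduction`).

Ellipsoid: optimality of L gives John's condition. The points y_i = L^{1/2}p_i lie in the unit ball,
and weights u_i on those of norm one give Σ u_i y_i y_iᵀ = I (`exists_weights_of_det_le_one`). Such
a contact point is, up to noise, a subconvex combination of vertices q_j of norm barely above 1, so
nearly all its weight sits on vertices with ⟨y_i, q_j⟩ ≥ 9/10. With the frame identity this places
the singular values of (q_1, …, q_r) in [22/25, 11/10] (`norm_le_analysis`, `analysis_le_norm`).

SPA: for such vertices the same concentration argument, after projection, shows that a column of
maximal norm is within 80μ of a single new vertex (`exists_vertex_of_max`). The constant 80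
reproduces itself, because earlier errors enter only through the conditioning of the projected
vertices (`lower_projection`).

Return: undoing L^{1/2}G costs 25/22 and applying F costs σ_max(F). As η is of order ε/σ_min(F), the
factor κ(F) arises only here (`vecNorm2_col_sub_col_le`). -/

open scoped InnerProductSpace

/-! ### Singular value bounds for the vertices, from a noisy tight frame. -/

namespace PrecondSPA

noncomputable section

/-! ### Weighted `ℓ²` norms -/

/-- The `ℓ²` norm of `a` with weights `u`. -/
def wnorm {ι : Type*} [Fintype ι] (u a : ι → ℝ) : ℝ := √(∑ i, u i * a i ^ 2)

section WeightedNorm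

variable {ι : Type*} [Fintype ι] {u a b : ι → ℝ}

theorem wnorm_nonneg : 0 ≤ wnorm u a := Real.sqrt_nonneg _

theorem sq_wnorm (hu : ∀ i, 0 ≤ u i) : wnorm u a ^ 2 = ∑ i, u i * a i ^ 2 :=
  Real.sq_sqrt (Finset.sum_nonneg fun i _ => mul_nonneg (hu i) (sq_nonneg _))

theorem wnorm_eq_norm (hu : ∀ i, 0 ≤ u i) :
    wnorm u a = ‖(WithLp.toLp 2 (fun i => √(u i) * a i) : EuclideanSpace ℝ ι)‖ := by
  rw [EuclideanSpace.norm_eq, wnorm]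
  congr 1
  refine Finset.sum_congr rfl fun i _ => ?_
  rw [Real.norm_eq_abs, sq_abs, mul_pow, Real.sq_sqrt (hu i)]

theorem wnorm_add_le (hu : ∀ i, 0 ≤ u i) :
    wnorm u (fun i => a i + b i) ≤ wnorm u a + wnorm u b := by
  rw [wnorm_eq_norm hu, wnorm_eq_norm hu, wnorm_eq_norm hu]
  refine le_trans (le_of_eq ?_) (norm_add_le _ _)
  congr 1
  ext i
  simp [mul_add]

theorem wnorm_le_of_sq_le {c : ℝ} (hc : 0 ≤ c) (h : ∑ i, u i * a i ^ 2 ≤ c ^ 2) :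
    wnorm u a ≤ c := by
  rw [wnorm]
  exact Real.sqrt_le_iff.2 ⟨hc, h⟩

theorem le_wnorm_of_sq_le {c : ℝ} (h : c ^ 2 ≤ ∑ i, u i * a i ^ 2) : c ≤ wnorm u a :=
  Real.le_sqrt_of_sq_le h

theorem wnorm_mono_abs (hu : ∀ i, 0 ≤ u i) (h : ∀ i, u i ≠ 0 → |a i| ≤ b i) :
    wnorm u a ≤ wnorm u b := by
  refine Real.sqrt_le_sqrt (Finset.sum_le_sum fun i _ => ?_)
  rcases eq_or_ne (u i) 0 with h0 | h0
  · simp [h0]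
  · have := h i h0
    refine mul_le_mul_of_nonneg_left ?_ (hu i)
    rw [← sq_abs]
    exact pow_le_pow_left₀ (abs_nonneg _) this 2

theorem wnorm_mul_const (hu : ∀ i, 0 ≤ u i) {c : ℝ} (hc : 0 ≤ c) :
    wnorm u (fun i => a i * c) = wnorm u a * c := by
  have h : ∑ i, u i * (a i * c) ^ 2 = (∑ i, u i * a i ^ 2) * c ^ 2 := by
    rw [Finset.sum_mul]; exact Finset.sum_congr rfl fun i _ => by ring
  rw [wnorm, h, Real.sqrt_mul (Finset.sum_nonneg fun i _ => mul_nonneg (hu i) (sq_nonneg _)),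
    Real.sqrt_sq hc, wnorm]

theorem abs_le_sqrt_sum_sq (a : ι → ℝ) (i : ι) : |a i| ≤ √(∑ i, a i ^ 2) :=
  Real.abs_le_sqrt (Finset.single_le_sum (f := fun i => a i ^ 2)
    (fun _ _ => sq_nonneg _) (Finset.mem_univ i))

end WeightedNorm

/-! ### Concentration of convex weights -/

/-- Markov's inequality. It turns a small average gap into a small total weight of the vertices with
a large gap. -/
theorem sum_filter_le_mul {κ : Type*} [Fintype κ] {w c : κ → ℝ} (hw : ∀ j, 0 ≤ w j)
    (hc : ∀ j, 0 ≤ c j) {p : κ → Prop} [DecidablePred p] {C : ℝ} (hp : ∀ j, p j → 1 ≤ C * c j)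
    (hC : 0 ≤ C) : ∑ j with p j, w j ≤ C * ∑ j, w j * c j := by
  rw [Finset.mul_sum]
  calc ∑ j with p j, w j ≤ ∑ j with p j, C * (w j * c j) :=
        Finset.sum_le_sum fun j hj => by
          have := hp j (Finset.mem_filter.1 hj).2
          nlinarith [hw j]
    _ ≤ ∑ j, C * (w j * c j) :=
        Finset.sum_le_sum_of_subset_of_nonneg (Finset.filter_subset _ _) fun j _ _ =>
          mul_nonneg hC (mul_nonneg (hw j) (hc j))

theorem sq_sum_mul_le_sum_mul_sq {κ : Type*} (s : Finset κ) {w z : κ → ℝ} (hw : ∀ j, 0 ≤ w j)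
    (hw1 : ∑ j ∈ s, w j ≤ 1) : (∑ j ∈ s, w j * z j) ^ 2 ≤ ∑ j ∈ s, w j * z j ^ 2 := by
  have h := Finset.sum_mul_sq_le_sq_mul_sq s (fun j => √(w j)) (fun j => √(w j) * z j)
  have e1 : ∀ j, √(w j) * (√(w j) * z j) = w j * z j := fun j => by
    rw [← mul_assoc, Real.mul_self_sqrt (hw j)]
  simp only [e1, mul_pow, Real.sq_sqrt (hw _)] at h
  refine h.trans (mul_le_of_le_one_left ?_ hw1)
  exact Finset.sum_nonneg fun j _ => mul_nonneg (hw j) (sq_nonneg _)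

/-- The midpoint of two vectors in a common cap has length at least `c`, so the parallelogram law
forces them together. Against the separation of well-conditioned vertices this shows that a cap
holds only one vertex. -/
theorem norm_sub_sq_le_of_inner_ge {V : Type*} [NormedAddCommGroup V] [InnerProductSpace ℝ V]
    {x a b : V} {M c : ℝ} (hx : ‖x‖ = 1) (ha : ‖a‖ ≤ M) (hb : ‖b‖ ≤ M) (hc : 0 ≤ c)
    (hxa : c ≤ ⟪x, a⟫_ℝ) (hxb : c ≤ ⟪x, b⟫_ℝ) : ‖a - b‖ ^ 2 ≤ 4 * M ^ 2 - 4 * c ^ 2 := by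
  have h1 : 2 * c ≤ ‖a + b‖ := by
    have := real_inner_le_norm x (a + b)
    rw [inner_add_right, hx, one_mul] at this
    linarith
  have h2 := parallelogram_law_with_norm ℝ a b
  nlinarith [norm_nonneg a, norm_nonneg b, norm_nonneg (a + b)]

theorem sum_sq_single_sub_single {κ : Type*} [Fintype κ] [DecidableEq κ] {j k : κ} (hjk : j ≠ k) :
    ∑ l, ((Pi.single j 1 - Pi.single k 1 : κ → ℝ) l) ^ 2 = 2 := by
  have e : ∀ l, ((Pi.single j 1 - Pi.single k 1 : κ → ℝ) l) ^ 2
      = (if l = j then 1 else 0) + (if l = k then 1 else 0) := by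
    intro l
    by_cases h5 : l = j
    · subst h5; simp [hjk]
    · by_cases h6 : l = k <;> simp [h5, h6, Ne.symm hjk]
  simp only [e, Finset.sum_add_distrib]
  norm_num

/-! ### Noisy tight frames in a simplex -/

/-- The points `y i` lie in the unit ball and are, up to the noise `ν`, subconvex combinations of
the vertices `q j`. The vertices occur among them, and the weights `u`, which live on points of norm
one, turn them into a tight frame. -/
structure IsNoisyFrame {ι κ V : Type*} [Fintype ι] [Fintype κ] [NormedAddCommGroup V]
    [InnerProductSpace ℝ V] (q : κ → V) (y ν : ι → V) (w : ι → κ → ℝ) (u : ι → ℝ) (τ : κ → ι) :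
    Prop where
  weight_nonneg : ∀ i j, 0 ≤ w i j
  weight_sum : ∀ i, ∑ j, w i j ≤ 1
  eq_comb : ∀ i, y i = ∑ j, w i j • q j + ν i
  vertex : ∀ j, y (τ j) = q j + ν (τ j)
  injective : Function.Injective τ
  norm_le : ∀ i, ‖y i‖ ≤ 1
  nonneg : ∀ i, 0 ≤ u i
  active : ∀ i, u i ≠ 0 → ‖y i‖ = 1
  frame : ∀ v, ∑ i, u i * ⟪y i, v⟫_ℝ ^ 2 = ‖v‖ ^ 2
  noise : ∑ i, ‖ν i‖ ^ 2 ≤ (1 / 1000) ^ 2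

namespace IsNoisyFrame

variable {ι κ V : Type*} [Fintype ι] [Fintype κ] [NormedAddCommGroup V] [InnerProductSpace ℝ V]
  {q : κ → V} {y ν : ι → V} {w : ι → κ → ℝ} {u : ι → ℝ} {τ : κ → ι}

theorem noise_le (h : IsNoisyFrame q y ν w u τ) (i : ι) : ‖ν i‖ ≤ 1 / 1000 := by
  have : ‖ν i‖ ^ 2 ≤ (1 / 1000) ^ 2 := (Finset.single_le_sum (f := fun i => ‖ν i‖ ^ 2)
    (fun _ _ => sq_nonneg _) (Finset.mem_univ i)).trans h.noise
  exact le_of_sq_le_sq this (by norm_num)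

/-- The frame identity tested at `y i` has `u i` among its terms and total 1. Hence the noise bound
survives weighting by `u`. -/
theorem le_one (h : IsNoisyFrame q y ν w u τ) (i : ι) : u i ≤ 1 := by
  by_cases h0 : u i = 0
  · simp [h0]
  have h1 := h.frame (y i)
  have h2 : u i * ⟪y i, y i⟫_ℝ ^ 2 ≤ ∑ k, u k * ⟪y k, y i⟫_ℝ ^ 2 :=
    Finset.single_le_sum (f := fun k => u k * ⟪y k, y i⟫_ℝ ^ 2)
      (fun k _ => mul_nonneg (h.nonneg k) (sq_nonneg _)) (Finset.mem_univ i)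
  rw [h1, real_inner_self_eq_norm_sq, h.active i h0] at h2
  linarith

theorem norm_vertex_le (h : IsNoisyFrame q y ν w u τ) (j : κ) : ‖q j‖ ≤ 1 + ‖ν (τ j)‖ := by
  have h1 : q j = y (τ j) - ν (τ j) := by rw [h.vertex j]; abel
  rw [h1]
  exact (norm_sub_le _ _).trans (by linarith [h.norm_le (τ j)])

theorem norm_vertex_le' (h : IsNoisyFrame q y ν w u τ) (j : κ) : ‖q j‖ ≤ 1001 / 1000 := by
  linarith [h.norm_vertex_le j, h.noise_le (τ j)]

/-- The error level of the `i`-th point. -/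
def defect (ν : ι → V) (w : ι → κ → ℝ) (τ : κ → ι) (i : ι) : ℝ :=
  ‖ν i‖ + ∑ j, w i j * ‖ν (τ j)‖

theorem gap_nonneg (h : IsNoisyFrame q y ν w u τ) (i : ι) (j : κ) :
    0 ≤ 1 + ‖ν (τ j)‖ - ⟪y i, q j⟫_ℝ := by
  have h1 := real_inner_le_norm (y i) (q j)
  have h2 := mul_le_of_le_one_left (norm_nonneg (q j)) (h.norm_le i)
  linarith [h.norm_vertex_le j]

/-- Expanding `1 = ⟪y i, y i⟫` along the combination shows that the inner products with the vertices
are, on average, almost as large as the bound `1 + ‖ν (τ j)‖` allows. -/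
theorem sum_gap_le (h : IsNoisyFrame q y ν w u τ) {i : ι} (hi : u i ≠ 0) :
    ∑ j, w i j * (1 + ‖ν (τ j)‖ - ⟪y i, q j⟫_ℝ) ≤ defect ν w τ i := by
  have h1 : ⟪y i, y i⟫_ℝ = 1 := by rw [real_inner_self_eq_norm_sq, h.active i hi]; norm_num
  have h2 : ⟪y i, y i⟫_ℝ = ∑ j, w i j * ⟪y i, q j⟫_ℝ + ⟪y i, ν i⟫_ℝ := by
    conv_lhs => rw [h.eq_comb i]
    rw [inner_add_left, ← h.eq_comb i, sum_inner]
    congr 1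
    · refine Finset.sum_congr rfl fun j _ => ?_
      rw [real_inner_smul_left, real_inner_comm]
    · rw [real_inner_comm]
  have h3 := real_inner_le_norm (y i) (ν i)
  rw [h.active i hi, one_mul] at h3
  have h4 : ∑ j, w i j * (1 + ‖ν (τ j)‖ - ⟪y i, q j⟫_ℝ)
      = ∑ j, w i j + ∑ j, w i j * ‖ν (τ j)‖ - ∑ j, w i j * ⟪y i, q j⟫_ℝ := by
    rw [← Finset.sum_add_distrib, ← Finset.sum_sub_distrib]
    exact Finset.sum_congr rfl fun j _ => by ring
  rw [h4, defect]
  linarith [h.weight_sum i]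

open Classical in
theorem far_weight_le (h : IsNoisyFrame q y ν w u τ) {i : ι} (hi : u i ≠ 0) :
    ∑ j with ¬ 9 / 10 ≤ ⟪y i, q j⟫_ℝ, w i j ≤ 10 * defect ν w τ i := by
  refine (sum_filter_le_mul (h.weight_nonneg i) (h.gap_nonneg i) (C := 10) ?_ (by norm_num)).trans
    (mul_le_mul_of_nonneg_left (h.sum_gap_le hi) (by norm_num))
  intro j hj
  have := norm_nonneg (ν (τ j))
  linarith

open Classical in
-- In the frame identity tested at `q j`, each near point contributes at least 0.81 `u i`, and the
-- total is at most 1.001². The constant comes from 1.001²/0.81 < 1.1123².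
theorem near_mass_le (h : IsNoisyFrame q y ν w u τ) (j : κ) :
    ∑ i with 9 / 10 ≤ ⟪y i, q j⟫_ℝ, u i * w i j ≤ (1.1123) ^ 2 := by
  have h1 : ∑ i with 9 / 10 ≤ ⟪y i, q j⟫_ℝ, (9 / 10) ^ 2 * (u i * w i j) ≤ ‖q j‖ ^ 2 := by
    rw [← h.frame]
    refine (Finset.sum_le_sum fun i hi => ?_).trans (Finset.sum_le_sum_of_subset_of_nonneg
      (Finset.filter_subset _ _) fun i _ _ => mul_nonneg (h.nonneg i) (sq_nonneg _))
    have hn := (Finset.mem_filter.1 hi).2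
    have hw : w i j ≤ 1 := (Finset.single_le_sum (f := w i) (fun k _ => h.weight_nonneg i k)
      (Finset.mem_univ j)).trans (h.weight_sum i)
    have := h.nonneg i
    calc (9 / 10) ^ 2 * (u i * w i j) ≤ (9 / 10) ^ 2 * (u i * 1) := by gcongr
      _ = u i * (9 / 10) ^ 2 := by ring
      _ ≤ _ := by gcongr
  rw [← Finset.mul_sum] at h1
  nlinarith [h.norm_vertex_le' j, norm_nonneg (q j)]

open Classical in
-- The crude bound of every |z_j| by the norm of `z` suffices, since the far weight is of the order
-- of the defect.
theorem wnorm_far_le (h : IsNoisyFrame q y ν w u τ) (z : κ → ℝ) :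
    wnorm u (fun i => ∑ j with ¬ 9 / 10 ≤ ⟪y i, q j⟫_ℝ, w i j * z j) ≤
      10 * wnorm u (defect ν w τ) * √(∑ j, z j ^ 2) := by
  have e : 10 * wnorm u (defect ν w τ) * √(∑ j, z j ^ 2)
      = wnorm u (fun i => defect ν w τ i * (10 * √(∑ j, z j ^ 2))) := by
    rw [wnorm_mul_const h.nonneg (by positivity)]; ring
  rw [e]
  refine wnorm_mono_abs h.nonneg fun i hi => ?_
  calc |∑ j with ¬ 9 / 10 ≤ ⟪y i, q j⟫_ℝ, w i j * z j|
      ≤ ∑ j with ¬ 9 / 10 ≤ ⟪y i, q j⟫_ℝ, |w i j * z j| := Finset.abs_sum_le_sum_abs _ _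
    _ ≤ ∑ j with ¬ 9 / 10 ≤ ⟪y i, q j⟫_ℝ, w i j * √(∑ j, z j ^ 2) :=
        Finset.sum_le_sum fun j _ => by
          rw [abs_mul, abs_of_nonneg (h.weight_nonneg i j)]
          exact mul_le_mul_of_nonneg_left (abs_le_sqrt_sum_sq z j) (h.weight_nonneg i j)
    _ ≤ _ := by
        rw [← Finset.sum_mul]
        have := mul_le_mul_of_nonneg_right (h.far_weight_le hi) (Real.sqrt_nonneg (∑ j, z j ^ 2))
        linarith

open Classical in
theorem wnorm_near_le (h : IsNoisyFrame q y ν w u τ) (z : κ → ℝ) :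
    wnorm u (fun i => ∑ j with 9 / 10 ≤ ⟪y i, q j⟫_ℝ, w i j * z j) ≤
      1.1123 * √(∑ j, z j ^ 2) := by
  refine wnorm_le_of_sq_le (by positivity) ?_
  rw [mul_pow, Real.sq_sqrt (Finset.sum_nonneg fun j _ => sq_nonneg _), Finset.mul_sum]
  calc ∑ i, u i * (∑ j with 9 / 10 ≤ ⟪y i, q j⟫_ℝ, w i j * z j) ^ 2
      ≤ ∑ i, u i * ∑ j with 9 / 10 ≤ ⟪y i, q j⟫_ℝ, w i j * z j ^ 2 := by
        refine Finset.sum_le_sum fun i _ => mul_le_mul_of_nonneg_left ?_ (h.nonneg i)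
        refine sq_sum_mul_le_sum_mul_sq _ (h.weight_nonneg i) (le_trans ?_ (h.weight_sum i))
        exact Finset.sum_le_sum_of_subset_of_nonneg (Finset.filter_subset _ _)
          fun j _ _ => h.weight_nonneg i j
    _ = ∑ j, (∑ i with 9 / 10 ≤ ⟪y i, q j⟫_ℝ, u i * w i j) * z j ^ 2 := by
        simp only [Finset.sum_filter, Finset.mul_sum, Finset.sum_mul]
        rw [Finset.sum_comm]
        refine Finset.sum_congr rfl fun j _ => Finset.sum_congr rfl fun i _ => ?_
        split_ifs <;> ring
    _ ≤ ∑ j, 1.1123 ^ 2 * z j ^ 2 :=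
        Finset.sum_le_sum fun j _ => mul_le_mul_of_nonneg_right (h.near_mass_le j) (sq_nonneg _)

theorem wnorm_comb_le (h : IsNoisyFrame q y ν w u τ) (z : κ → ℝ) :
    wnorm u (fun i => ∑ j, w i j * z j) ≤
      (1.1123 + 10 * wnorm u (defect ν w τ)) * √(∑ j, z j ^ 2) := by
  classical
  rw [add_mul]
  refine le_trans (le_of_eq ?_) ((wnorm_add_le h.nonneg).trans
    (add_le_add (h.wnorm_near_le z) (h.wnorm_far_le z)))
  congr 1
  ext i
  exact (Finset.sum_filter_add_sum_filter_not _ _ _).symm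

theorem wnorm_noise_le (h : IsNoisyFrame q y ν w u τ) :
    wnorm u (fun i => ‖ν i‖) ≤ 1 / 1000 :=
  wnorm_le_of_sq_le (by norm_num) <| (Finset.sum_le_sum fun i _ =>
    mul_le_of_le_one_left (sq_nonneg _) (h.le_one i)).trans h.noise

/-- The defect contains a weighted combination of noise norms, to which `wnorm_comb_le` applies; its
bound again contains the defect norm δ. The resulting δ ≤ 0.001 + (1.1123 + 10δ)·0.001 closes
because δ reappears with the factor 0.01. -/
theorem wnorm_defect_le (h : IsNoisyFrame q y ν w u τ) : wnorm u (defect ν w τ) ≤ 2.2 / 1000 := by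
  have h1 := h.wnorm_comb_le (fun j => ‖ν (τ j)‖)
  have h2 : √(∑ j, ‖ν (τ j)‖ ^ 2) ≤ 1 / 1000 := by
    refine Real.sqrt_le_iff.2 ⟨by norm_num, le_trans ?_ h.noise⟩
    classical
    rw [← Finset.sum_image (f := fun i => ‖ν i‖ ^ 2) (s := Finset.univ) (g := τ)
      (fun a _ b _ hab => h.injective hab)]
    exact Finset.sum_le_sum_of_subset_of_nonneg (Finset.subset_univ _) fun _ _ _ => sq_nonneg _
  have h3 : wnorm u (defect ν w τ)
      ≤ wnorm u (fun i => ‖ν i‖) + wnorm u (fun i => ∑ j, w i j * ‖ν (τ j)‖) :=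
    wnorm_add_le h.nonneg
  have h4 := h.wnorm_noise_le
  have h5 : 0 ≤ wnorm u (defect ν w τ) := wnorm_nonneg
  nlinarith [Real.sqrt_nonneg (∑ j, ‖ν (τ j)‖ ^ 2)]

theorem wnorm_comb_le' (h : IsNoisyFrame q y ν w u τ) (z : κ → ℝ) :
    wnorm u (fun i => ∑ j, w i j * z j) ≤ 1.135 * √(∑ j, z j ^ 2) := by
  refine (h.wnorm_comb_le z).trans (mul_le_mul_of_nonneg_right ?_ (Real.sqrt_nonneg _))
  linarith [h.wnorm_defect_le]

theorem wnorm_inner_noise_le (h : IsNoisyFrame q y ν w u τ) (v : V) :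
    wnorm u (fun i => ⟪ν i, v⟫_ℝ) ≤ 1 / 1000 * ‖v‖ := by
  refine (wnorm_mono_abs h.nonneg (b := fun i => ‖ν i‖ * ‖v‖) fun i _ =>
    abs_real_inner_le_norm _ _).trans ?_
  rw [wnorm_mul_const h.nonneg (norm_nonneg _)]
  exact mul_le_mul_of_nonneg_right h.wnorm_noise_le (norm_nonneg _)

theorem wnorm_inner (h : IsNoisyFrame q y ν w u τ) (v : V) :
    wnorm u (fun i => ⟪y i, v⟫_ℝ) = ‖v‖ := by
  rw [wnorm, h.frame, Real.sqrt_sq (norm_nonneg _)]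

theorem inner_eq (h : IsNoisyFrame q y ν w u τ) (v : V) (i : ι) :
    ⟪y i, v⟫_ℝ = ∑ j, w i j * ⟪q j, v⟫_ℝ + ⟪ν i, v⟫_ℝ := by
  rw [h.eq_comb i, inner_add_left, sum_inner]
  simp only [real_inner_smul_left]

theorem norm_le_wnorm_comb (h : IsNoisyFrame q y ν w u τ) (v : V) :
    999 / 1000 * ‖v‖ ≤ wnorm u (fun i => ∑ j, w i j * ⟪q j, v⟫_ℝ) := by
  have h1 := h.wnorm_inner v
  simp only [h.inner_eq v] at h1
  have h2 := wnorm_add_le h.nonneg (a := fun i => ∑ j, w i j * ⟪q j, v⟫_ℝ)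
    (b := fun i => ⟪ν i, v⟫_ℝ)
  linarith [h.wnorm_inner_noise_le v]

theorem wnorm_comb_le_norm (h : IsNoisyFrame q y ν w u τ) (v : V) :
    wnorm u (fun i => ∑ j, w i j * ⟪q j, v⟫_ℝ) ≤ 1001 / 1000 * ‖v‖ := by
  have h2 := wnorm_add_le h.nonneg (a := fun i => ⟪y i, v⟫_ℝ) (b := fun i => ⟪ν i, -v⟫_ℝ)
  have h3 := h.wnorm_inner_noise_le (-v)
  rw [norm_neg] at h3
  simp only [inner_neg_right, h.inner_eq v, add_neg_cancel_right] at h2 h3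
  have h1 := h.wnorm_inner v
  simp only [h.inner_eq v] at h1
  linarith

/-- The analysis map of the vertices is bounded below. -/
theorem norm_le_analysis (h : IsNoisyFrame q y ν w u τ) (v : V) :
    22 / 25 * ‖v‖ ≤ √(∑ j, ⟪q j, v⟫_ℝ ^ 2) := by
  have h1 := h.norm_le_wnorm_comb v
  have h2 := h.wnorm_comb_le' (fun j => ⟪q j, v⟫_ℝ)
  have := norm_nonneg v
  -- Here 0.999/1.135 > 22/25.
  linarith

variable [FiniteDimensional ℝ V]

/-- The lower bound makes the analysis map injective, hence bijective in equal dimensions. Dual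
vectors then carry bounds over to the transposed map. -/
theorem exists_dual (h : IsNoisyFrame q y ν w u τ) (hV : Module.finrank ℝ V = Fintype.card κ)
    (z : κ → ℝ) : ∃ v : V, ∀ j, ⟪q j, v⟫_ℝ = z j := by
  let T : V →ₗ[ℝ] (κ → ℝ) := LinearMap.pi fun j => (innerSL ℝ (q j)).toLinearMap
  have hT : ∀ v j, T v j = ⟪q j, v⟫_ℝ := fun v j => rfl
  have hinj : Function.Injective T := by
    rw [injective_iff_map_eq_zero]
    intro v hv
    have h1 := h.norm_le_analysis v
    have h2 : ∑ j, ⟪q j, v⟫_ℝ ^ 2 = 0 :=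
      Finset.sum_eq_zero fun j _ => by rw [← hT, hv]; simp
    rw [h2, Real.sqrt_zero] at h1
    exact norm_le_zero_iff.1 (by linarith)
  have hsurj := (LinearMap.injective_iff_surjective_of_finrank_eq_finrank
    (by rw [hV, Module.finrank_fintype_fun_eq_card])).1 hinj
  obtain ⟨v, hv⟩ := hsurj z
  exact ⟨v, fun j => by rw [← hT, hv]⟩

/-- The synthesis map of the vertices is bounded below. -/
theorem le_norm_synthesis (h : IsNoisyFrame q y ν w u τ)
    (hV : Module.finrank ℝ V = Fintype.card κ) (z : κ → ℝ) :
    22 / 25 * √(∑ j, z j ^ 2) ≤ ‖∑ j, z j • q j‖ := by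
  obtain ⟨v, hv⟩ := h.exists_dual hV z
  have h1 : ⟪∑ j, z j • q j, v⟫_ℝ = ∑ j, z j ^ 2 := by
    rw [sum_inner]
    exact Finset.sum_congr rfl fun j _ => by rw [real_inner_smul_left, hv, sq]
  have h2 := real_inner_le_norm (∑ j, z j • q j) v
  have h3 := h.norm_le_analysis v
  simp only [hv] at h3
  have h4 : √(∑ j, z j ^ 2) ^ 2 = ∑ j, z j ^ 2 :=
    Real.sq_sqrt (Finset.sum_nonneg fun _ _ => sq_nonneg _)
  rcases (Real.sqrt_nonneg (∑ j, z j ^ 2)).eq_or_lt with h0 | h0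
  · rw [← h0]; simp
  · rw [h1, ← h4] at h2
    have h5 : √(∑ j, z j ^ 2) * (22 / 25 * √(∑ j, z j ^ 2))
        ≤ √(∑ j, z j ^ 2) * ‖∑ j, z j • q j‖ := by
      nlinarith [norm_nonneg (∑ j, z j • q j)]
    exact le_of_mul_le_mul_left h5 h0

theorem near_unique (h : IsNoisyFrame q y ν w u τ)
    (hV : Module.finrank ℝ V = Fintype.card κ) {i : ι} (hi : u i ≠ 0) {j k : κ}
    (hj : 9 / 10 ≤ ⟪y i, q j⟫_ℝ) (hk : 9 / 10 ≤ ⟪y i, q k⟫_ℝ) : j = k := by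
  classical
  by_contra hjk
  -- The cap gives ‖q_j − q_k‖² ≤ 4·1.001² − 4·0.81 < 0.77, while the synthesis bound gives at least
  -- 2·0.88² > 1.54.
  have h1 := norm_sub_sq_le_of_inner_ge (h.active i hi) (h.norm_vertex_le' j)
    (h.norm_vertex_le' k) (by norm_num) hj hk
  have h2 := h.le_norm_synthesis hV (Pi.single j 1 - Pi.single k 1)
  have h3 : ∑ l, (Pi.single j 1 - Pi.single k 1 : κ → ℝ) l • q l = q j - q k := by
    simp [sub_smul, Finset.sum_sub_distrib, Pi.single_apply]
  rw [h3, sum_sq_single_sub_single hjk] at h2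
  have h5 : (22 / 25 * √2) ^ 2 ≤ ‖q j - q k‖ ^ 2 := pow_le_pow_left₀ (by positivity) h2 2
  rw [mul_pow, Real.sq_sqrt (by norm_num)] at h5
  norm_num at h1 h5
  linarith

/-- The vector dual to `q j` isolates the weights `w i j`, and its length is at least 1/‖q_j‖ ≥
1000/1001. -/
theorem le_sum_sq_weight (h : IsNoisyFrame q y ν w u τ)
    (hV : Module.finrank ℝ V = Fintype.card κ) (j : κ) : 0.996 ≤ ∑ i, u i * w i j ^ 2 := by
  classical
  obtain ⟨v, hv⟩ := h.exists_dual hV (Pi.single j 1)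
  have h1 := h.norm_le_wnorm_comb v
  have h2 : wnorm u (fun i => ∑ k, w i k * ⟪q k, v⟫_ℝ) = wnorm u (fun i => w i j) := by
    congr 1; ext i; simp [hv, Pi.single_apply]
  have h3 := real_inner_le_norm (q j) v
  rw [hv, Pi.single_eq_same] at h3
  have h4 := h.norm_vertex_le' j
  have h5 : 1000 / 1001 ≤ ‖v‖ := by nlinarith [norm_nonneg v]
  rw [h2] at h1
  rw [← sq_wnorm h.nonneg]
  have h6 : 0.998 ≤ wnorm u (fun i => w i j) := by norm_num at *; linarith
  nlinarith

open Classical in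
-- An active point has at most one near vertex, so the square of the near sum has no cross terms and
-- decouples into the near masses Σ u_i w_ij². These are almost 1, as the far part is at most
-- (10·0.0022)².
theorem le_wnorm_near (h : IsNoisyFrame q y ν w u τ)
    (hV : Module.finrank ℝ V = Fintype.card κ) (z : κ → ℝ) :
    0.997 * √(∑ j, z j ^ 2) ≤
      wnorm u (fun i => ∑ j with 9 / 10 ≤ ⟪y i, q j⟫_ℝ, w i j * z j) := by
  have hfar : ∀ j, ∑ i with ¬ 9 / 10 ≤ ⟪y i, q j⟫_ℝ, u i * w i j ^ 2 ≤ 0.0005 := by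
    intro j
    have h1 : ∑ i with ¬ 9 / 10 ≤ ⟪y i, q j⟫_ℝ, u i * w i j ^ 2
        ≤ ∑ i, u i * (defect ν w τ i * 10) ^ 2 := by
      refine (Finset.sum_le_sum fun i hi => ?_).trans (Finset.sum_le_sum_of_subset_of_nonneg
        (Finset.filter_subset _ _) fun i _ _ => mul_nonneg (h.nonneg i) (sq_nonneg _))
      rcases eq_or_ne (u i) 0 with h0 | h0
      · simp [h0]
      · refine mul_le_mul_of_nonneg_left (pow_le_pow_left₀ (h.weight_nonneg i j) ?_ 2) (h.nonneg i)
        have := Finset.single_le_sum (f := w i)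
          (s := Finset.univ.filter fun j => ¬ 9 / 10 ≤ ⟪y i, q j⟫_ℝ)
          (fun k _ => h.weight_nonneg i k) (a := j)
          (Finset.mem_filter.2 ⟨Finset.mem_univ _, (Finset.mem_filter.1 hi).2⟩)
        linarith [h.far_weight_le h0]
    rw [← sq_wnorm h.nonneg, wnorm_mul_const h.nonneg (by norm_num)] at h1
    have h2 := h.wnorm_defect_le
    have h3 : 0 ≤ wnorm u (defect ν w τ) := wnorm_nonneg
    refine h1.trans ((pow_le_pow_left₀ (by positivity)
      (mul_le_mul_of_nonneg_right h2 (by norm_num)) 2).trans (by norm_num))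
  have hnear : ∀ j, 0.9955 ≤ ∑ i with 9 / 10 ≤ ⟪y i, q j⟫_ℝ, u i * w i j ^ 2 := by
    intro j
    have h1 := h.le_sum_sq_weight hV j
    rw [← Finset.sum_filter_add_sum_filter_not Finset.univ
      (fun i => 9 / 10 ≤ ⟪y i, q j⟫_ℝ)] at h1
    have h2 := hfar j
    norm_num at h1 h2 ⊢
    linarith
  refine le_wnorm_of_sq_le ?_
  rw [mul_pow, Real.sq_sqrt (Finset.sum_nonneg fun j _ => sq_nonneg _), Finset.mul_sum]
  calc ∑ j, 0.997 ^ 2 * z j ^ 2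
      ≤ ∑ j, (∑ i with 9 / 10 ≤ ⟪y i, q j⟫_ℝ, u i * w i j ^ 2) * z j ^ 2 :=
        Finset.sum_le_sum fun j _ => mul_le_mul_of_nonneg_right
          (le_trans (by norm_num) (hnear j)) (sq_nonneg _)
    _ = ∑ i, u i * ∑ j with 9 / 10 ≤ ⟪y i, q j⟫_ℝ, (w i j * z j) ^ 2 := by
        simp only [Finset.sum_filter, Finset.mul_sum, Finset.sum_mul]
        rw [Finset.sum_comm]
        refine Finset.sum_congr rfl fun j _ => Finset.sum_congr rfl fun i _ => ?_
        split_ifs <;> ring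
    _ = ∑ i, u i * (∑ j with 9 / 10 ≤ ⟪y i, q j⟫_ℝ, w i j * z j) ^ 2 := by
        refine Finset.sum_congr rfl fun i _ => ?_
        rcases eq_or_ne (u i) 0 with h0 | h0
        · simp [h0]
        congr 1
        rcases (Finset.univ.filter fun j => 9 / 10 ≤ ⟪y i, q j⟫_ℝ).eq_empty_or_nonempty with
          he | ⟨j, hj⟩
        · simp [he]
        · have : (Finset.univ.filter fun j => 9 / 10 ≤ ⟪y i, q j⟫_ℝ) = {j} :=
            Finset.eq_singleton_iff_unique_mem.2 ⟨hj, fun k hk => h.near_unique hV h0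
              (Finset.mem_filter.1 hk).2 (Finset.mem_filter.1 hj).2⟩
          simp [this]

/-- The analysis map of the vertices is bounded above. -/
theorem analysis_le_norm (h : IsNoisyFrame q y ν w u τ)
    (hV : Module.finrank ℝ V = Fintype.card κ) (v : V) :
    √(∑ j, ⟪q j, v⟫_ℝ ^ 2) ≤ 11 / 10 * ‖v‖ := by
  classical
  have h1 := h.le_wnorm_near hV (fun j => ⟪q j, v⟫_ℝ)
  have h2 := h.wnorm_comb_le_norm v
  have h3 := h.wnorm_far_le (fun j => -⟪q j, v⟫_ℝ)
  simp only [even_two, Even.neg_pow] at h3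
  -- The near sum is the full sum minus the far sum. With Z the norm of the analysis vector, 0.997 Z
  -- ≤ 1.001‖v‖ + 0.022 Z.
  have h4 := wnorm_add_le h.nonneg (a := fun i => ∑ j, w i j * ⟪q j, v⟫_ℝ)
    (b := fun i => ∑ j with ¬ 9 / 10 ≤ ⟪y i, q j⟫_ℝ, w i j * -⟪q j, v⟫_ℝ)
  have e : (fun i => ∑ j, w i j * ⟪q j, v⟫_ℝ +
      ∑ j with ¬ 9 / 10 ≤ ⟪y i, q j⟫_ℝ, w i j * -⟪q j, v⟫_ℝ)
      = fun i => ∑ j with 9 / 10 ≤ ⟪y i, q j⟫_ℝ, w i j * ⟪q j, v⟫_ℝ := by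
    ext i
    rw [← Finset.sum_filter_add_sum_filter_not Finset.univ (fun j => 9 / 10 ≤ ⟪y i, q j⟫_ℝ)]
    simp only [mul_neg, Finset.sum_neg_distrib, add_neg_cancel_right]
  rw [e] at h4
  have h5 := mul_le_mul_of_nonneg_right h.wnorm_defect_le
    (Real.sqrt_nonneg (∑ j, ⟪q j, v⟫_ℝ ^ 2))
  have := norm_nonneg v
  linarith

/-- The synthesis map of the vertices is bounded above. -/
theorem norm_synthesis_le (h : IsNoisyFrame q y ν w u τ)
    (hV : Module.finrank ℝ V = Fintype.card κ) (z : κ → ℝ) :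
    ‖∑ j, z j • q j‖ ≤ 11 / 10 * √(∑ j, z j ^ 2) := by
  have h1 : ‖∑ j, z j • q j‖ ^ 2 = ∑ j, z j * ⟪q j, ∑ j, z j • q j⟫_ℝ := by
    rw [← real_inner_self_eq_norm_sq]
    conv_lhs => rw [sum_inner]
    simp only [real_inner_smul_left]
  have h2 := Real.sum_mul_le_sqrt_mul_sqrt Finset.univ z (fun j => ⟪q j, ∑ j, z j • q j⟫_ℝ)
  rw [← h1] at h2
  have h3 := h.analysis_le_norm hV (∑ j, z j • q j)
  have h4 := Real.sqrt_nonneg (∑ j, z j ^ 2)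
  rcases (norm_nonneg (∑ j, z j • q j)).eq_or_lt with h0 | h0
  · rw [← h0]; positivity
  · nlinarith

end IsNoisyFrame

end

end PrecondSPA

/-! ### SPA on a well-conditioned, slightly perturbed simplex. -/

namespace PrecondSPA

noncomputable section

/-! ### Robustness of the selection step -/

/-- The points `y i` are, up to noise of size `μ`, subconvex combinations of the vertices `q j`,
which occur among them and are well conditioned. -/
structure IsNearSimplex {ι κ V : Type*} [Fintype κ] [NormedAddCommGroup V]
    [InnerProductSpace ℝ V] (q : κ → V) (y : ι → V) (w : ι → κ → ℝ) (τ : κ → ι) (μ : ℝ) :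
    Prop where
  weight_nonneg : ∀ i j, 0 ≤ w i j
  weight_sum : ∀ i, ∑ j, w i j ≤ 1
  noise : ∀ i, ‖y i - ∑ j, w i j • q j‖ ≤ μ
  vertex : ∀ j, ‖y (τ j) - q j‖ ≤ μ
  lower : ∀ z : κ → ℝ, 22 / 25 * √(∑ j, z j ^ 2) ≤ ‖∑ j, z j • q j‖
  upper : ∀ j, ‖q j‖ ≤ 11 / 10
  small : √(Fintype.card κ) * μ ≤ 1 / 900

theorem exists_extend_sum_eq {σ κ V : Type*} [Fintype σ] [Fintype κ] [AddCommGroup V]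
    [Module ℝ V] {e : σ → κ} (he : Function.Injective e) (c : σ → ℝ) (g : κ → V) :
    ∃ c' : κ → ℝ, (∀ j, (∀ i, e i ≠ j) → c' j = 0) ∧ ∑ j, c' j ^ 2 = ∑ i, c i ^ 2 ∧
      ∑ j, c' j • g j = ∑ i, c i • g (e i) := by
  have h0 : ∀ j, (∀ i, e i ≠ j) → Function.extend e c 0 j = 0 := fun j hj =>
    Function.extend_apply' _ _ _ (by rintro ⟨i, hi⟩; exact hj i hi)
  have h1 : ∀ i, Function.extend e c 0 (e i) = c i := fun i => he.extend_apply _ _ _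
  refine ⟨Function.extend e c 0, h0, ?_, ?_⟩
  · refine (Fintype.sum_of_injective e he _ _ (fun j hj => ?_) fun i => ?_).symm
    · rw [h0 j fun i hi => hj ⟨i, hi⟩]; simp
    · rw [h1]
  · refine (Fintype.sum_of_injective e he _ _ (fun j hj => ?_) fun i => ?_).symm
    · rw [h0 j fun i hi => hj ⟨i, hi⟩]; simp
    · rw [h1]

theorem norm_sum_smul_sub_le {κ V : Type*} [Fintype κ] [NormedAddCommGroup V]
    [InnerProductSpace ℝ V] {q : κ → V} {M : ℝ} (hq : ∀ j, ‖q j‖ ≤ M) {w : κ → ℝ}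
    (hw : ∀ j, 0 ≤ w j) (hw1 : ∑ j, w j ≤ 1) (l : κ) :
    ‖∑ j, w j • q j - q l‖ ≤ 2 * M * (1 - w l) := by
  classical
  have hM : 0 ≤ M := (norm_nonneg _).trans (hq l)
  rw [← Finset.add_sum_erase _ _ (Finset.mem_univ l)] at hw1 ⊢
  have h1 : w l • q l + ∑ j ∈ Finset.univ.erase l, w j • q j - q l
      = ∑ j ∈ Finset.univ.erase l, w j • q j - (1 - w l) • q l := by
    rw [sub_smul, one_smul]; abel
  have h0 : 0 ≤ ∑ j ∈ Finset.univ.erase l, w j := Finset.sum_nonneg fun j _ => hw j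
  have h2 : ‖∑ j ∈ Finset.univ.erase l, w j • q j‖ ≤ (∑ j ∈ Finset.univ.erase l, w j) * M := by
    rw [Finset.sum_mul]
    refine (norm_sum_le _ _).trans (Finset.sum_le_sum fun j _ => ?_)
    rw [norm_smul, Real.norm_of_nonneg (hw j)]
    exact mul_le_mul_of_nonneg_left (hq j) (hw j)
  have h3 : ‖(1 - w l) • q l‖ ≤ (1 - w l) * M := by
    rw [norm_smul, Real.norm_of_nonneg (by linarith)]
    exact mul_le_mul_of_nonneg_left (hq l) (by linarith)
  rw [h1]
  refine (norm_sub_le _ _).trans ?_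
  nlinarith

namespace IsNearSimplex

variable {ι κ V : Type*} [Fintype κ] [NormedAddCommGroup V] [InnerProductSpace ℝ V]
  {q : κ → V} {y : ι → V} {w : ι → κ → ℝ} {τ : κ → ι} {μ : ℝ}

theorem noise_small (h : IsNearSimplex q y w τ μ) (j : κ) : μ ≤ 1 / 900 := by
  have h1 : (1 : ℝ) ≤ √(Fintype.card κ) := by
    rw [Real.one_le_sqrt]
    exact_mod_cast Fintype.card_pos_iff.2 ⟨j⟩
  have h2 : 0 ≤ μ := (norm_nonneg _).trans (h.vertex j)
  nlinarith [h.small]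

variable [FiniteDimensional ℝ V]

/-- Vertices that have not been found yet stay well conditioned under the projection onto the
orthogonal complement of the points found so far. -/
theorem lower_projection (h : IsNearSimplex q y w τ μ) {I : Finset ι} {f : ι → κ}
    (hf : Set.InjOn f I) (hI : ∀ i ∈ I, ‖y i - q (f i)‖ ≤ 80 * μ) {z : κ → ℝ}
    (hz : ∀ i ∈ I, z (f i) = 0) :
    79 / 100 * √(∑ j, z j ^ 2) ≤
      ‖(Submodule.span ℝ (y '' I))ᗮ.starProjection (∑ j, z j • q j)‖ := by
  set x := ∑ j, z j • q j with hx
  obtain ⟨c, hc⟩ := Submodule.mem_span_image_finset_iff_exists_fun (R := ℝ).1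
    ((Submodule.span ℝ (y '' I)).starProjection_apply_mem x)
  have he : Function.Injective (fun i : I => f i) := fun a b hab =>
    Subtype.ext (hf a.2 b.2 hab)
  obtain ⟨c', h0, hsq, hsum⟩ := exists_extend_sum_eq he c q
  rw [Submodule.starProjection_orthogonal_val, ← hc]
  have h1 : x - ∑ i, c i • y i = ∑ j, (z j - c' j) • q j - ∑ i, c i • (y i - q (f i)) := by
    simp only [sub_smul, smul_sub, Finset.sum_sub_distrib, hsum, hx]
    abel
  -- The supports are disjoint: `z` vanishes on found vertices and `c'` off them. Subtracting the
  -- projection therefore cannot shrink the coefficient vector.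
  have h2 : ∑ j, (z j - c' j) ^ 2 = ∑ j, z j ^ 2 + ∑ i, c i ^ 2 := by
    rw [← hsq, ← Finset.sum_add_distrib]
    refine Finset.sum_congr rfl fun j _ => ?_
    have : z j * c' j = 0 := by
      by_cases hj : ∃ i : I, f i = j
      · obtain ⟨i, rfl⟩ := hj
        rw [hz i i.2, zero_mul]
      · rw [h0 j (by simpa using hj), mul_zero]
    linear_combination -2 * this
  have h3 := h.lower (fun j => z j - c' j)
  rw [h2] at h3
  set s := √(∑ j, z j ^ 2 + ∑ i, c i ^ 2) with hs
  have hcn : 0 ≤ ∑ i, c i ^ 2 := Finset.sum_nonneg fun _ _ => sq_nonneg _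
  have hzn : 0 ≤ ∑ j, z j ^ 2 := Finset.sum_nonneg fun _ _ => sq_nonneg _
  have hzs : √(∑ j, z j ^ 2) ≤ s := Real.sqrt_le_sqrt (by linarith)
  have hcs : √(∑ i, c i ^ 2) ≤ s := Real.sqrt_le_sqrt (by linarith)
  -- Cauchy–Schwarz over at most `Fintype.card κ` found points costs the square root that `small`
  -- absorbs. What remains is 22/25 − 80/900 > 79/100.
  have h4 : ‖∑ i, c i • (y i - q (f i))‖ ≤ 80 / 900 * s := by
    rcases isEmpty_or_nonempty I with hI0 | ⟨⟨i₀⟩⟩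
    · simp only [Finset.univ_eq_empty, Finset.sum_empty, norm_zero]
      positivity
    have hμ : 0 ≤ 80 * μ := (norm_nonneg _).trans (hI i₀ i₀.2)
    have h5 : ‖∑ i, c i • (y i - q (f i))‖ ≤ ∑ i : I, |c i| * (80 * μ) := by
      refine (norm_sum_le _ _).trans (Finset.sum_le_sum fun i _ => ?_)
      rw [norm_smul, Real.norm_eq_abs]
      exact mul_le_mul_of_nonneg_left (hI i i.2) (abs_nonneg _)
    have h6 := Real.sum_mul_le_sqrt_mul_sqrt Finset.univ (fun i : I => |c i|) (fun _ => 80 * μ)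
    simp only [sq_abs, Finset.sum_const, nsmul_eq_mul] at h6
    rw [Real.sqrt_mul (by positivity), Real.sqrt_sq hμ] at h6
    have h7 : √((Finset.univ : Finset I).card : ℝ) ≤ √(Fintype.card κ) := by
      refine Real.sqrt_le_sqrt ?_
      exact_mod_cast Fintype.card_le_of_injective _ he
    have h8 := h.small
    calc _ ≤ _ := h5
      _ ≤ _ := h6
      _ ≤ s * (√(Fintype.card κ) * (80 * μ)) := by gcongr
      _ ≤ 80 / 900 * s := by
          have : 0 ≤ s := Real.sqrt_nonneg _
          nlinarith
  rw [h1]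
  have h9 := norm_sub_norm_le (∑ j, (z j - c' j) • q j) (∑ i, c i • (y i - q (f i)))
  have : 0 ≤ s := Real.sqrt_nonneg _
  linarith

/-- A point whose projection has maximal norm is close to a vertex that has not been found yet. -/
theorem exists_vertex_of_max (h : IsNearSimplex q y w τ μ) {I : Finset ι} {f : ι → κ}
    (hf : Set.InjOn f I) (hI : ∀ i ∈ I, ‖y i - q (f i)‖ ≤ 80 * μ) (hcard : I.card < Fintype.card κ)
    {i : ι} (hmax : ∀ k, ‖(Submodule.span ℝ (y '' I))ᗮ.starProjection (y k)‖ ≤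
      ‖(Submodule.span ℝ (y '' I))ᗮ.starProjection (y i)‖) :
    (Submodule.span ℝ (y '' I))ᗮ.starProjection (y i) ≠ 0 ∧
      ∃ l, (∀ k ∈ I, f k ≠ l) ∧ ‖y i - q l‖ ≤ 80 * μ := by
  classical
  set Q := (Submodule.span ℝ (y '' I))ᗮ.starProjection with hQ
  have hQle : ∀ v, ‖Q v‖ ≤ ‖v‖ := Submodule.norm_starProjection_apply_le _
  have hlow : ∀ z : κ → ℝ, (∀ k ∈ I, z (f k) = 0) →
      79 / 100 * √(∑ j, z j ^ 2) ≤ ‖Q (∑ j, z j • q j)‖ := fun z hz => h.lower_projection hf hI hz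
  set J := I.image f with hJ
  have hJc : Jᶜ.Nonempty := by
    rw [← Finset.card_pos, Finset.card_compl]
    have : J.card ≤ I.card := Finset.card_image_le
    omega
  have hmemJ : ∀ {j}, j ∈ Jᶜ ↔ ∀ k ∈ I, f k ≠ j := by
    intro j; simp [hJ]
  obtain ⟨j₀, hj₀, hm⟩ := Finset.exists_max_image Jᶜ (fun j => ‖Q (q j)‖) hJc
  -- `m` is the maximum over unfound vertices, and in fact over all: found ones project to at most
  -- 80μ ≤ 80/900, unfound ones to at least 79/100.
  set m := ‖Q (q j₀)‖ with hmdef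
  have hμ : 0 ≤ μ := (norm_nonneg _).trans (h.vertex j₀)
  have hμ' := h.noise_small j₀
  have hm1 : 79 / 100 ≤ m := by
    have := hlow (Pi.single j₀ 1) fun k hk => Pi.single_eq_of_ne (hmemJ.1 hj₀ k hk) _
    simpa [Pi.single_apply] using this
  have hm2 : m ≤ 11 / 10 := (hQle _).trans (h.upper j₀)
  have hleJ : ∀ j, j ∉ Jᶜ → ‖Q (q j)‖ ≤ 80 * μ := by
    intro j hj
    obtain ⟨k, hk, rfl⟩ := Finset.mem_image.1 (Finset.notMem_compl.1 hj)
    have h1 : Q (y k) = 0 := Submodule.starProjection_orthogonal_apply_eq_zero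
      (Submodule.subset_span ⟨k, hk, rfl⟩)
    have h2 : ‖Q (y k - q (f k))‖ ≤ 80 * μ := (hQle _).trans (hI k hk)
    rwa [map_sub, h1, zero_sub, norm_neg] at h2
  have hle : ∀ j, ‖Q (q j)‖ ≤ m := by
    intro j
    by_cases hj : j ∈ Jᶜ
    · exact hm j hj
    · linarith [hleJ j hj]
  have hyi : m - μ ≤ ‖Q (y i)‖ := by
    have h1 := hmax (τ j₀)
    have h2 := (hQle _).trans (h.vertex j₀)
    rw [map_sub] at h2
    have h3 := norm_sub_norm_le (Q (q j₀)) (Q (y (τ j₀)))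
    rw [norm_sub_rev] at h3
    linarith
  refine ⟨fun h0 => by rw [h0, norm_zero] at hyi; linarith, ?_⟩
  set x := Q (∑ j, w i j • q j) with hx
  have hxn : m - 2 * μ ≤ ‖x‖ := by
    have h2 := (hQle _).trans (h.noise i)
    rw [map_sub] at h2
    have h3 := norm_sub_norm_le (Q (y i)) x
    linarith
  have hx0 : 0 < ‖x‖ := by linarith
  set x' := ‖x‖⁻¹ • x with hx'
  have hx'n : ‖x'‖ = 1 := by
    rw [hx', norm_smul, norm_inv, norm_norm, inv_mul_cancel₀ hx0.ne']
  have hsum : ∑ j, w i j * ⟪x', Q (q j)⟫_ℝ = ‖x‖ := by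
    have h1 : ⟪x', x⟫_ℝ = ∑ j, w i j * ⟪x', Q (q j)⟫_ℝ := by
      conv_lhs => rw [hx, map_sum, inner_sum]
      simp only [map_smul, real_inner_smul_right]
    rw [← h1, hx', real_inner_smul_left, real_inner_self_eq_norm_sq]
    field_simp
  have hin : ∀ j, ⟪x', Q (q j)⟫_ℝ ≤ ‖Q (q j)‖ := fun j => by
    have := real_inner_le_norm x' (Q (q j))
    rwa [hx'n, one_mul] at this
  have hgap : ∀ j, 0 ≤ m - ⟪x', Q (q j)⟫_ℝ := fun j => by linarith [hin j, hle j]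
  have hgapsum : ∑ j, w i j * (m - ⟪x', Q (q j)⟫_ℝ) = (∑ j, w i j) * m - ‖x‖ := by
    rw [← hsum, Finset.sum_mul, ← Finset.sum_sub_distrib]
    exact Finset.sum_congr rfl fun j _ => by ring
  have hw1 := h.weight_sum i
  -- A far vertex has gap above m/10 ≥ 0.079 > 1/13, while the weighted gaps add up to at most m −
  -- ‖x‖ ≤ 2μ.
  have hfar : ∑ j with ¬ 9 / 10 * m ≤ ⟪x', Q (q j)⟫_ℝ, w i j ≤ 13 * (2 * μ) := by
    refine (sum_filter_le_mul (h.weight_nonneg i) hgap (C := 13) ?_ (by norm_num)).trans ?_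
    · intro j hj
      linarith
    · rw [hgapsum]
      nlinarith
  have hwlow : 1 - 2.6 * μ ≤ ∑ j, w i j := by
    have h1 : 0 ≤ (∑ j, w i j) * m - ‖x‖ := by
      rw [← hgapsum]
      exact Finset.sum_nonneg fun j _ => mul_nonneg (h.weight_nonneg i j) (hgap j)
    have h2 : (1 - 2.6 * μ) * m ≤ (∑ j, w i j) * m := by nlinarith
    exact le_of_mul_le_mul_right h2 (by linarith)
  have hnearJ : ∀ j, 9 / 10 * m ≤ ⟪x', Q (q j)⟫_ℝ → j ∈ Jᶜ := by
    intro j hj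
    by_contra hjJ
    linarith [hin j, hleJ j hjJ]
  have huniq : ∀ j k, 9 / 10 * m ≤ ⟪x', Q (q j)⟫_ℝ → 9 / 10 * m ≤ ⟪x', Q (q k)⟫_ℝ → j = k := by
    intro j k hj hk
    by_contra hjk
    -- The cap bound 0.76 m² ≤ 0.76·1.21 < 0.92 contradicts the separation 2·0.79² > 1.24.
    have h1 := norm_sub_sq_le_of_inner_ge hx'n (hle j) (hle k) (by positivity) hj hk
    have h2 := hlow (Pi.single j 1 - Pi.single k 1) fun a ha => by
      rw [Pi.sub_apply, Pi.single_eq_of_ne (hmemJ.1 (hnearJ j hj) a ha),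
        Pi.single_eq_of_ne (hmemJ.1 (hnearJ k hk) a ha), sub_zero]
    have h3 : ∑ l, (Pi.single j 1 - Pi.single k 1 : κ → ℝ) l • q l = q j - q k := by
      simp [sub_smul, Finset.sum_sub_distrib, Pi.single_apply]
    rw [h3, sum_sq_single_sub_single hjk, map_sub] at h2
    have h5 : (79 / 100 * √2) ^ 2 ≤ ‖Q (q j) - Q (q k)‖ ^ 2 :=
      pow_le_pow_left₀ (by positivity) h2 2
    rw [mul_pow, Real.sq_sqrt (by norm_num)] at h5
    nlinarith
  have hsplit := Finset.sum_filter_add_sum_filter_not Finset.univ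
    (fun j => 9 / 10 * m ≤ ⟪x', Q (q j)⟫_ℝ) (w i)
  rcases (Finset.univ.filter fun j => 9 / 10 * m ≤ ⟪x', Q (q j)⟫_ℝ).eq_empty_or_nonempty with
    he | ⟨l, hl⟩
  · rw [he, Finset.sum_empty, zero_add] at hsplit
    linarith
  have hl' := (Finset.mem_filter.1 hl).2
  have hs : (Finset.univ.filter fun j => 9 / 10 * m ≤ ⟪x', Q (q j)⟫_ℝ) = {l} :=
    Finset.eq_singleton_iff_unique_mem.2 ⟨hl, fun k hk => huniq k l (Finset.mem_filter.1 hk).2 hl'⟩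
  rw [hs, Finset.sum_singleton] at hsplit
  refine ⟨l, hmemJ.1 (hnearJ l hl'), ?_⟩
  -- The weight of `l` is at least 1 − 2.6μ − 26μ, so the distance is at most μ + 2.2·28.6μ < 64μ,
  -- within the allowed 80μ.
  have h1 := norm_sum_smul_sub_le h.upper (h.weight_nonneg i) hw1 l
  have h2 := norm_add_le (y i - ∑ j, w i j • q j) (∑ j, w i j • q j - q l)
  rw [sub_add_sub_cancel] at h2
  linarith [h.noise i]

end IsNearSimplex

/-! ### Runs of SPA -/

/-- The columns of a matrix as points of Euclidean space. -/
def colPoint {n m : ℕ} (A : Matrix (Fin n) (Fin m) ℝ) (k : Fin m) : EuclideanSpace ℝ (Fin n) :=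
  WithLp.toLp 2 (A.col k)

theorem inner_colPoint {n m : ℕ} (A : Matrix (Fin n) (Fin m) ℝ) (i k : Fin m) :
    ⟪colPoint A i, colPoint A k⟫_ℝ = A.col i ⬝ᵥ A.col k := by
  rw [colPoint, colPoint, EuclideanSpace.inner_toLp_toLp, dotProduct_comm]
  rfl

theorem colPoint_eq_zero {n m : ℕ} {A : Matrix (Fin n) (Fin m) ℝ} {k : Fin m} :
    colPoint A k = 0 ↔ A.col k = 0 := by
  rw [colPoint, WithLp.toLp_eq_zero]

theorem colPoint_deflate {n m : ℕ} (S : Matrix (Fin n) (Fin m) ℝ) (i k : Fin m) :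
    colPoint ((1 - (S.col i ⬝ᵥ S.col i)⁻¹ • Matrix.vecMulVec (S.col i) (S.col i)) * S) k =
      colPoint S k - ((⟪colPoint S i, colPoint S i⟫_ℝ)⁻¹ * ⟪colPoint S i, colPoint S k⟫_ℝ) •
        colPoint S i := by
  rw [inner_colPoint, inner_colPoint]
  ext a
  simp only [colPoint, Matrix.col_apply, Matrix.sub_mul, Matrix.one_mul, Matrix.smul_mul, Matrix.sub_apply,
    Matrix.smul_apply, smul_eq_mul, Matrix.vecMulVec_mul, Matrix.vecMulVec_apply,
    PiLp.sub_apply, PiLp.smul_apply, Matrix.vecMul, dotProduct]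
  ring

/-- One deflation step extends the space that has been projected out by one point. -/
theorem starProjection_insert {V : Type*} [NormedAddCommGroup V] [InnerProductSpace ℝ V]
    [FiniteDimensional ℝ V] {ι : Type*} [DecidableEq ι] (y : ι → V) (I : Finset ι) (i : ι) {t : V}
    (ht : t = (Submodule.span ℝ (y '' I))ᗮ.starProjection (y i)) (ht0 : t ≠ 0) (v : V) :
    (Submodule.span ℝ (y '' (insert i I : Finset ι)))ᗮ.starProjection v =
      (Submodule.span ℝ (y '' I))ᗮ.starProjection v -
        ((⟪t, t⟫_ℝ)⁻¹ * ⟪t, (Submodule.span ℝ (y '' I))ᗮ.starProjection v⟫_ℝ) • t := by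
  set K := Submodule.span ℝ (y '' I) with hK
  set s := Kᗮ.starProjection v with hs
  set c := (⟪t, t⟫_ℝ)⁻¹ * ⟪t, s⟫_ℝ with hc
  have hK' : Submodule.span ℝ (y '' (insert i I : Finset ι)) = Submodule.span ℝ {y i} ⊔ K := by
    rw [Finset.coe_insert, Set.image_insert_eq, Submodule.span_insert]
  have htK : t ∈ Kᗮ := ht ▸ Submodule.starProjection_apply_mem _ _
  have hsK : s ∈ Kᗮ := Submodule.starProjection_apply_mem _ _
  have hrK : s - c • t ∈ Kᗮ := Kᗮ.sub_mem hsK (Kᗮ.smul_mem c htK)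
  have hyt : y i - t ∈ K := by
    rw [ht, Submodule.starProjection_orthogonal_val, sub_sub_cancel]
    exact Submodule.starProjection_apply_mem _ _
  have hvs : v - s ∈ K := by
    rw [hs, Submodule.starProjection_orthogonal_val, sub_sub_cancel]
    exact Submodule.starProjection_apply_mem _ _
  have htt : ⟪t, t⟫_ℝ ≠ 0 := inner_self_ne_zero.2 ht0
  rw [hK']
  refine Submodule.eq_starProjection_of_mem_orthogonal ?_ (Submodule.le_orthogonal_orthogonal _ ?_)
  · rw [← Submodule.inf_orthogonal]
    refine ⟨?_, hrK⟩
    rw [SetLike.mem_coe, Submodule.mem_orthogonal_singleton_iff_inner_right]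
    have h1 : ⟪y i - t, s - c • t⟫_ℝ = 0 := (Submodule.mem_orthogonal _ _).1 hrK _ hyt
    have h2 : ⟪t, s - c • t⟫_ℝ = 0 := by
      rw [inner_sub_right, real_inner_smul_right, hc]
      field_simp
      ring
    rw [inner_sub_left, h2, sub_zero] at h1
    exact h1
  · have h1 : v - (s - c • t) = c • y i + ((v - s) - c • (y i - t)) := by
      rw [smul_sub]; abel
    rw [h1]
    exact Submodule.add_mem_sup (Submodule.smul_mem _ _ (Submodule.mem_span_singleton_self _))
      (K.sub_mem hvs (K.smul_mem c hyt))

section Run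

variable {n m : ℕ} {κ : Type*} {A : Matrix (Fin n) (Fin m) ℝ}
  {q : κ → EuclideanSpace ℝ (Fin n)} {w : Fin m → κ → ℝ} {τ : κ → Fin m} {μ : ℝ}

/-- What holds in every state that SPA can reach on the columns of `A`. -/
structure SPAInvariant (A : Matrix (Fin n) (Fin m) ℝ) (q : κ → EuclideanSpace ℝ (Fin n)) (μ : ℝ)
    (s : SPAState n m) (f : Fin m → κ) : Prop where
  injOn : Set.InjOn f s.I
  close : ∀ i ∈ s.I, ‖colPoint A i - q (f i)‖ ≤ 80 * μ
  proj : ∀ k, colPoint s.S k =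
    (Submodule.span ℝ (colPoint A '' s.I))ᗮ.starProjection (colPoint A k)

theorem SPAInvariant.norm_max {s : SPAState n m} {f : Fin m → κ} (h : SPAInvariant A q μ s f)
    {i : Fin m} (hi : ∀ k, s.S.col k ⬝ᵥ s.S.col k ≤ s.S.col i ⬝ᵥ s.S.col i) (k : Fin m) :
    ‖(Submodule.span ℝ (colPoint A '' s.I))ᗮ.starProjection (colPoint A k)‖ ≤
      ‖(Submodule.span ℝ (colPoint A '' s.I))ᗮ.starProjection (colPoint A i)‖ := by
  rw [← h.proj, ← h.proj]
  have := hi k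
  rw [← inner_colPoint, ← inner_colPoint, real_inner_self_eq_norm_sq,
    real_inner_self_eq_norm_sq] at this
  exact le_of_sq_le_sq this (norm_nonneg _)

variable [Fintype κ]

theorem SPAInvariant.step (hA : IsNearSimplex q (colPoint A) w τ μ) {s s' : SPAState n m}
    {f : Fin m → κ} (h : SPAInvariant A q μ s f) (hs : SPAStep (Fintype.card κ) s s') :
    s'.I.card = s.I.card + 1 ∧ ∃ f', SPAInvariant A q μ s' f' := by
  obtain ⟨hcard, i, hmax, hne, hS, hI⟩ := hs
  have hne' : colPoint s.S i ≠ 0 := fun h0 => hne (colPoint_eq_zero.1 h0)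
  -- Found columns have been projected to zero, so no index repeats. The growth of the index set is
  -- what rules out infinite runs.
  have hiI : i ∉ s.I := by
    intro hi
    apply hne'
    rw [h.proj]
    exact Submodule.starProjection_orthogonal_apply_eq_zero (Submodule.subset_span ⟨i, hi, rfl⟩)
  obtain ⟨-, l, hl, hil⟩ := hA.exists_vertex_of_max h.injOn h.close hcard (h.norm_max hmax)
  have hupd : ∀ k ∈ s.I, Function.update f i l k = f k := fun k hk =>
    Function.update_of_ne (ne_of_mem_of_not_mem hk hiI) _ _
  refine ⟨by rw [hI, Finset.card_insert_of_notMem hiI], Function.update f i l, ?_, ?_, ?_⟩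
  · rw [hI, Finset.coe_insert, Set.injOn_insert (by simpa using hiI)]
    refine ⟨fun a ha b hb hab => ?_, ?_⟩
    · rw [hupd a ha, hupd b hb] at hab
      exact h.injOn ha hb hab
    · rintro ⟨k, hk, hkl⟩
      rw [hupd k hk, Function.update_self] at hkl
      exact hl k hk hkl
  · intro k hk
    rw [hI, Finset.mem_insert] at hk
    rcases hk with rfl | hk
    · rwa [Function.update_self]
    · rw [hupd k hk]
      exact h.close k hk
  · intro k
    rw [hS, colPoint_deflate, hI, starProjection_insert _ _ i (h.proj i) hne', ← h.proj k]

theorem SPAReaches.invariant (hA : IsNearSimplex q (colPoint A) w τ μ) [Nonempty κ]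
    {s : SPAState n m} (hs : SPAReaches A (Fintype.card κ) s) : ∃ f, SPAInvariant A q μ s f := by
  induction hs with
  | refl =>
    refine ⟨fun _ => Classical.arbitrary κ, by simp, by simp, fun k => ?_⟩
    simp only [Finset.coe_empty, Set.image_empty, Submodule.span_empty,
      Submodule.starProjection_orthogonal_val, Submodule.starProjection_bot,
      zero_apply, sub_zero]
  | tail _ hstep ih =>
    obtain ⟨f, hf⟩ := ih
    exact (hf.step hA hstep).2

theorem SPAReaches.card_le {r : ℕ} {s : SPAState n m} (hs : SPAReaches A r s) : s.I.card ≤ r := by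
  induction hs with
  | refl => simp
  | tail _ hstep _ =>
    obtain ⟨hcard, i, -, -, -, hI⟩ := hstep
    rw [hI]
    exact (Finset.card_insert_le _ _).trans hcard

theorem spaTerminates_of_isNearSimplex (hA : IsNearSimplex q (colPoint A) w τ μ) [Nonempty κ] :
    SPATerminates A (Fintype.card κ) := by
  constructor
  · rintro ⟨run, h0, hrun⟩
    have hreach : ∀ k, SPAReaches A (Fintype.card κ) (run k) := by
      intro k
      induction k with
      | zero => rw [h0]; exact Relation.ReflTransGen.refl
      | succ k ih => exact ih.tail (hrun k)
    have hcard : ∀ k, k ≤ (run k).I.card := by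
      intro k
      induction k with
      | zero => exact Nat.zero_le _
      | succ k ih =>
        obtain ⟨f, hf⟩ := (hreach k).invariant hA
        rw [(hf.step hA (hrun k)).1]
        omega
    have := (hreach (Fintype.card κ + 1)).card_le
    have := hcard (Fintype.card κ + 1)
    omega
  · intro s hs hcard
    obtain ⟨f, hf⟩ := hs.invariant hA
    have : Nonempty (Fin m) := ⟨τ (Classical.arbitrary κ)⟩
    obtain ⟨i, hi⟩ := Finite.exists_max fun k => s.S.col k ⬝ᵥ s.S.col k
    have h1 := (hA.exists_vertex_of_max hf.injOn hf.close hcard (hf.norm_max hi)).1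
    rw [← hf.proj] at h1
    exact ⟨⟨_, _⟩, hcard, i, hi, fun h0 => h1 (colPoint_eq_zero.2 h0), rfl, rfl⟩

theorem exists_equiv_of_spaReturns (hA : IsNearSimplex q (colPoint A) w τ μ) [Nonempty κ]
    {I : Finset (Fin m)} (hI : SPAReturns A (Fintype.card κ) I) :
    ∃ order : κ ≃ I, ∀ j, ‖colPoint A (order j) - q j‖ ≤ 80 * μ := by
  obtain ⟨S, hS, hcard⟩ := hI
  obtain ⟨f, hf⟩ := hS.invariant hA
  have hinj : Function.Injective (fun i : I => f i) := fun a b hab =>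
    Subtype.ext (hf.injOn a.2 b.2 hab)
  have hbij : Function.Bijective (fun i : I => f i) :=
    (Fintype.bijective_iff_injective_and_card _).2 ⟨hinj, by
      rw [Fintype.card_coe]; exact le_antisymm hS.card_le hcard⟩
  refine ⟨(Equiv.ofBijective _ hbij).symm, fun j => ?_⟩
  have h1 : f ((Equiv.ofBijective _ hbij).symm j) = j :=
    (Equiv.ofBijective _ hbij).apply_symm_apply j
  have h2 := hf.close _ ((Equiv.ofBijective _ hbij).symm j).2
  rwa [h1] at h2

end Run

end

end PrecondSPA

/-! ### Minimum volume ellipsoids: John's condition and existence. -/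

namespace PrecondSPA

noncomputable section

open Matrix Filter Topology

/-! ### Optimality conditions for enclosing ellipsoids -/

theorem abs_dotProduct_mulVec_le {n : ℕ} (G : Matrix (Fin n) (Fin n) ℝ) (x : Fin n → ℝ) :
    |x ⬝ᵥ G *ᵥ x| ≤ (∑ j, ∑ k, |G j k|) * (x ⬝ᵥ x) := by
  have hx : ∀ j, x j ^ 2 ≤ x ⬝ᵥ x := fun j => by
    rw [sq]
    exact Finset.single_le_sum (f := fun j => x j * x j) (fun _ _ => mul_self_nonneg _)
      (Finset.mem_univ j)
  generalize x ⬝ᵥ x = c at hx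
  simp only [dotProduct, mulVec, Finset.mul_sum]
  rw [Finset.sum_mul]
  refine (Finset.abs_sum_le_sum_abs _ _).trans (Finset.sum_le_sum fun j _ => ?_)
  rw [Finset.sum_mul]
  refine (Finset.abs_sum_le_sum_abs _ _).trans (Finset.sum_le_sum fun k _ => ?_)
  rw [abs_mul, abs_mul, mul_left_comm]
  refine mul_le_mul_of_nonneg_left ?_ (abs_nonneg _)
  have h1 := hx j
  have h2 := hx k
  have h3 := two_mul_le_add_sq |x j| |x k|
  rw [sq_abs, sq_abs] at h3
  linarith

theorem eventually_posDef_one_add_smul {n : ℕ} {G : Matrix (Fin n) (Fin n) ℝ}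
    (hG : G.IsHermitian) : ∀ᶠ t : ℝ in 𝓝[>] 0, (1 + t • G).PosDef := by
  set C := ∑ j, ∑ k, |G j k| with hC
  have h1 : ∀ᶠ t : ℝ in 𝓝[>] 0, t * C < 1 := by
    have : Tendsto (fun t : ℝ => t * C) (𝓝[>] 0) (𝓝 (0 * C)) :=
      ((continuous_id.mul continuous_const).tendsto _).mono_left nhdsWithin_le_nhds
    rw [zero_mul] at this
    exact this.eventually (gt_mem_nhds one_pos)
  filter_upwards [h1, self_mem_nhdsWithin] with t ht ht0
  have ht0 : 0 < t := ht0
  refine PosDef.of_dotProduct_mulVec_pos ?_ fun x hx => ?_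
  · refine isHermitian_one.add ?_
    rw [IsHermitian, conjTranspose_smul, hG.eq, star_trivial]
  · rw [star_trivial, add_mulVec, one_mulVec, dotProduct_add, smul_mulVec, dotProduct_smul,
      smul_eq_mul]
    have hxx : 0 < x ⬝ᵥ x := by
      have := dotProduct_self_eq_zero (v := x)
      exact lt_of_le_of_ne (Finset.sum_nonneg fun _ _ => mul_self_nonneg _)
        fun h => hx (this.1 h.symm)
    have h2 := neg_le_of_abs_le (abs_dotProduct_mulVec_le G x)
    rw [← hC] at h2
    nlinarith

/-- The expansion det(I + tG) = 1 + t tr G + O(t²), with a polynomial remainder. -/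
theorem eventually_one_lt_det_one_add_smul {n : ℕ} {G : Matrix (Fin n) (Fin n) ℝ}
    (hG : 0 < G.trace) : ∀ᶠ t : ℝ in 𝓝[>] 0, 1 < (1 + t • G).det := by
  set p := (det (1 + (Polynomial.X : Polynomial ℝ) • G.map Polynomial.C)).divX.divX
  have h1 : Tendsto (fun t : ℝ => G.trace + p.eval t * t) (𝓝[>] 0)
      (𝓝 (G.trace + p.eval 0 * 0)) :=
    ((continuous_const.add (p.continuous.mul continuous_id)).tendsto _).mono_left
      nhdsWithin_le_nhds
  rw [mul_zero, add_zero] at h1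
  filter_upwards [h1.eventually (lt_mem_nhds hG), self_mem_nhdsWithin] with t ht ht0
  have ht0 : 0 < t := ht0
  rw [det_one_add_smul]
  nlinarith [mul_pos ht0 ht]

theorem dotProduct_mulVec_eq_sum {n : ℕ} (G : Matrix (Fin n) (Fin n) ℝ) (x : Fin n → ℝ) :
    x ⬝ᵥ G *ᵥ x = ∑ j, ∑ k, G j k * vecMulVec x x j k := by
  simp only [dotProduct, mulVec, Finset.mul_sum, vecMulVec_apply]
  exact Finset.sum_congr rfl fun j _ => Finset.sum_congr rfl fun k _ => by ring

/-- If the unit ball is the largest-determinant ellipsoid containing the points `y i`, then some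
of these on the unit sphere carry weights that make them a tight frame. -/
theorem exists_weights_of_det_le_one {n : ℕ} (hn : n ≠ 0) {ι : Type*} [Fintype ι]
    (y : ι → Fin n → ℝ) (hy : ∀ i, y i ⬝ᵥ y i ≤ 1)
    (hopt : ∀ M : Matrix (Fin n) (Fin n) ℝ, M.PosDef → (∀ i, y i ⬝ᵥ M *ᵥ y i ≤ 1) → M.det ≤ 1) :
    ∃ u : ι → ℝ, (∀ i, 0 ≤ u i) ∧ (∀ i, u i ≠ 0 → y i ⬝ᵥ y i = 1) ∧
      ∑ i, u i • vecMulVec (y i) (y i) = 1 := by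
  classical
  have hn' : (n : ℝ) ≠ 0 := by exact_mod_cast hn
  set S : Set (Matrix (Fin n) (Fin n) ℝ) :=
    (fun i => vecMulVec (y i) (y i)) '' {i | y i ⬝ᵥ y i = 1} with hS
  -- The contact matrices y yᵀ have trace one, so the identity must be normalised to trace one
  -- before asking for a convex combination.
  by_cases hmem : (n : ℝ)⁻¹ • (1 : Matrix (Fin n) (Fin n) ℝ) ∈ convexHull ℝ S
  · obtain ⟨σ, _, c, z, hc0, -, hz, hsum⟩ := mem_convexHull_iff_exists_fintype.1 hmem
    choose idx hidx hidx' using hz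
    refine ⟨fun i => n * ∑ k with idx k = i, c k, fun i => ?_, fun i hi => ?_, ?_⟩
    · exact mul_nonneg (Nat.cast_nonneg _) (Finset.sum_nonneg fun k _ => hc0 k)
    · by_contra hne
      refine hi (mul_eq_zero_of_right _ (Finset.sum_eq_zero ?_))
      intro k hk
      exact absurd ((Finset.mem_filter.1 hk).2 ▸ hidx k) hne
    · have h1 : ∑ i, (∑ k with idx k = i, c k) • vecMulVec (y i) (y i) = ∑ k, c k • z k := by
        rw [← Finset.sum_fiberwise Finset.univ idx fun k => c k • z k]
        refine Finset.sum_congr rfl fun i _ => ?_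
        rw [Finset.sum_smul]
        refine Finset.sum_congr rfl fun k hk => ?_
        rw [← hidx' k, (Finset.mem_filter.1 hk).2]
      simp only [mul_smul, ← Finset.smul_sum]
      rw [h1, hsum, smul_smul, mul_inv_cancel₀ hn', one_smul]
  · exfalso
    have : LocallyConvexSpace ℝ (Matrix (Fin n) (Fin n) ℝ) :=
      inferInstanceAs (LocallyConvexSpace ℝ (Fin n → Fin n → ℝ))
    have hSfin : S.Finite := (Set.toFinite _).image _
    obtain ⟨f, c, hfS, hf1⟩ := geometric_hahn_banach_closed_point (convex_convexHull ℝ S)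
      (hSfin.isCompact_convexHull ℝ).isClosed hmem
    set H : Matrix (Fin n) (Fin n) ℝ := of fun j k => f (single j k 1) with hH
    have hf : ∀ X, f X = ∑ j, ∑ k, H j k * X j k := by
      intro X
      conv_lhs => rw [matrix_eq_sum_single X]
      simp only [map_sum]
      refine Finset.sum_congr rfl fun j _ => Finset.sum_congr rfl fun k _ => ?_
      have : single j k (X j k) = X j k • single j k (1 : ℝ) := by
        rw [smul_single, smul_eq_mul, mul_one]
      rw [this, map_smul, smul_eq_mul, hH, of_apply, mul_comm]
    have hquad : ∀ x, x ⬝ᵥ H *ᵥ x = f (vecMulVec x x) := fun x => by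
      rw [hf, dotProduct_mulVec_eq_sum]
    -- The separating functional, symmetrised and shifted, is negative on contact points and has
    -- positive trace. For small t > 0, I + tG is then feasible (other points have slack) with
    -- determinant above 1.
    set G := (1 / 2 : ℝ) • (H + Hᵀ) - c • (1 : Matrix (Fin n) (Fin n) ℝ) with hG
    have hGh : G.IsHermitian := by
      rw [IsHermitian, conjTranspose_eq_transpose_of_trivial, hG, transpose_sub, transpose_smul,
        transpose_add, transpose_transpose, transpose_smul, transpose_one, add_comm]
    have hGq : ∀ x, x ⬝ᵥ G *ᵥ x = f (vecMulVec x x) - c * (x ⬝ᵥ x) := by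
      intro x
      have hT : x ⬝ᵥ Hᵀ *ᵥ x = x ⬝ᵥ H *ᵥ x := by
        rw [mulVec_transpose, dotProduct_comm, ← dotProduct_mulVec]
      rw [hG, sub_mulVec, smul_mulVec, smul_mulVec, add_mulVec, one_mulVec, dotProduct_sub,
        dotProduct_smul, dotProduct_smul, dotProduct_add, hT, hquad, smul_eq_mul, smul_eq_mul]
      ring
    have hGtr : 0 < G.trace := by
      have h1 : f ((n : ℝ)⁻¹ • (1 : Matrix (Fin n) (Fin n) ℝ)) = (n : ℝ)⁻¹ * H.trace := by
        rw [map_smul, hf, smul_eq_mul, trace]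
        simp [one_apply, diag]
      have h2 : G.trace = H.trace - c * n := by
        rw [hG, trace_sub, trace_smul, trace_smul, trace_add, trace_transpose, trace_one,
          Fintype.card_fin, smul_eq_mul, smul_eq_mul]
        ring
      rw [h1, inv_mul_eq_div, lt_div_iff₀ (by positivity)] at hf1
      linarith
    have hfeas : ∀ᶠ t : ℝ in 𝓝[>] 0, ∀ i, y i ⬝ᵥ (1 + t • G) *ᵥ y i ≤ 1 := by
      rw [eventually_all]
      intro i
      have h0 : ∀ t : ℝ, y i ⬝ᵥ (1 + t • G) *ᵥ y i = y i ⬝ᵥ y i + t * (y i ⬝ᵥ G *ᵥ y i) := by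
        intro t
        rw [add_mulVec, one_mulVec, dotProduct_add, smul_mulVec, dotProduct_smul, smul_eq_mul]
      simp only [h0]
      rcases (hy i).lt_or_eq with hlt | heq
      · have : Tendsto (fun t : ℝ => y i ⬝ᵥ y i + t * (y i ⬝ᵥ G *ᵥ y i)) (𝓝[>] 0)
            (𝓝 (y i ⬝ᵥ y i + 0 * (y i ⬝ᵥ G *ᵥ y i))) :=
          ((continuous_const.add (continuous_id.mul continuous_const)).tendsto _).mono_left
            nhdsWithin_le_nhds
        rw [zero_mul, add_zero] at this
        exact (this.eventually (gt_mem_nhds hlt)).mono fun t ht => ht.le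
      · filter_upwards [self_mem_nhdsWithin] with t ht0
        have ht0 : 0 < t := ht0
        have h1 := hfS _ (subset_convexHull ℝ S ⟨i, heq, rfl⟩)
        rw [hGq, heq]
        nlinarith
    obtain ⟨t, ht1, ht2, ht3⟩ := ((eventually_posDef_one_add_smul hGh).and
      ((eventually_one_lt_det_one_add_smul hGtr).and hfeas)).exists
    exact absurd (hopt _ ht1 ht3) (not_le.2 ht2)

/-! ### The square root of the optimal ellipsoid -/

theorem sqrtMatrix_transpose {n : ℕ} (L : Matrix (Fin n) (Fin n) ℝ) (hL : L.PosDef) :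
    (sqrtMatrix L hL)ᵀ = sqrtMatrix L hL := by
  rw [sqrtMatrix, transpose_mul, transpose_mul, transpose_transpose, diagonal_transpose,
    Matrix.mul_assoc]

theorem sqrtMatrix_mul_self {n : ℕ} (L : Matrix (Fin n) (Fin n) ℝ) (hL : L.PosDef) :
    sqrtMatrix L hL * sqrtMatrix L hL = L := by
  set U : Matrix (Fin n) (Fin n) ℝ := hL.isHermitian.eigenvectorUnitary.1 with hU
  have hUU : Uᵀ * U = 1 := by
    have := Unitary.coe_star_mul_self hL.isHermitian.eigenvectorUnitary
    rwa [star_eq_conjTranspose, conjTranspose_eq_transpose_of_trivial] at this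
  have hs := hL.isHermitian.spectral_theorem
  rw [Unitary.conjStarAlgAut_apply, star_eq_conjTranspose, conjTranspose_eq_transpose_of_trivial,
    ← hU] at hs
  conv_rhs => rw [hs]
  have hD : diagonal (fun i => √(hL.isHermitian.eigenvalues i)) *
      diagonal (fun i => √(hL.isHermitian.eigenvalues i)) =
      diagonal (RCLike.ofReal ∘ hL.isHermitian.eigenvalues) := by
    rw [diagonal_mul_diagonal]
    congr 1
    ext i
    exact Real.mul_self_sqrt (hL.eigenvalues_pos i).le
  rw [sqrtMatrix, ← hU, ← hD]
  simp only [Matrix.mul_assoc]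
  rw [← Matrix.mul_assoc Uᵀ U, hUU, Matrix.one_mul]

theorem isUnit_det_sqrtMatrix {n : ℕ} (L : Matrix (Fin n) (Fin n) ℝ) (hL : L.PosDef) :
    IsUnit (sqrtMatrix L hL).det := by
  have h := congrArg Matrix.det (sqrtMatrix_mul_self L hL)
  rw [det_mul] at h
  rw [isUnit_iff_ne_zero]
  intro h0
  rw [h0, mul_zero] at h
  exact hL.det_pos.ne h

theorem dotProduct_sqrtMatrix_mulVec {n : ℕ} {L : Matrix (Fin n) (Fin n) ℝ} (hL : L.PosDef)
    (M : Matrix (Fin n) (Fin n) ℝ) (x : Fin n → ℝ) :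
    (sqrtMatrix L hL *ᵥ x) ⬝ᵥ M *ᵥ (sqrtMatrix L hL *ᵥ x) =
      x ⬝ᵥ (sqrtMatrix L hL * M * sqrtMatrix L hL) *ᵥ x := by
  have h : sqrtMatrix L hL *ᵥ x = x ᵥ* sqrtMatrix L hL := by
    rw [← vecMul_transpose, sqrtMatrix_transpose]
  conv_lhs => enter [1]; rw [h]
  rw [← dotProduct_mulVec, mulVec_mulVec, mulVec_mulVec, Matrix.mul_assoc]

/-- With B = L^{1/2}, the substitution M ↦ BMB preserves feasibility and multiplies determinants by
det L. In the new coordinates the identity is optimal. -/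
theorem MVEEOptimal.exists_weights {n m : ℕ} (hn : n ≠ 0) {P : Matrix (Fin n) (Fin m) ℝ}
    {L : Matrix (Fin n) (Fin n) ℝ} (hL : MVEEOptimal (Set.range P.col) L) :
    (∀ i, (sqrtMatrix L hL.1.1 * P).col i ⬝ᵥ (sqrtMatrix L hL.1.1 * P).col i ≤ 1) ∧
    ∃ u : Fin m → ℝ, (∀ i, 0 ≤ u i) ∧
      (∀ i, u i ≠ 0 →
        (sqrtMatrix L hL.1.1 * P).col i ⬝ᵥ (sqrtMatrix L hL.1.1 * P).col i = 1) ∧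
      ∀ v, ∑ i, u i * ((sqrtMatrix L hL.1.1 * P).col i ⬝ᵥ v) ^ 2 = v ⬝ᵥ v := by
  obtain ⟨⟨hpos, hfeas⟩, hopt⟩ := id hL
  set B := sqrtMatrix L hL.1.1 with hB
  have hBB : B * B = L := sqrtMatrix_mul_self _ _
  have hBT : Bᵀ = B := sqrtMatrix_transpose _ _
  have hBdet : IsUnit B.det := isUnit_det_sqrtMatrix _ _
  have hcol : ∀ i, (B * P).col i = B *ᵥ P.col i := fun i => by
    ext a; rfl
  have hquad : ∀ (M : Matrix (Fin n) (Fin n) ℝ) i,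
      (B * P).col i ⬝ᵥ M *ᵥ (B * P).col i = P.col i ⬝ᵥ (B * M * B) *ᵥ P.col i := fun M i => by
    rw [hcol, dotProduct_sqrtMatrix_mulVec]
  have hball : ∀ i, (B * P).col i ⬝ᵥ (B * P).col i ≤ 1 := fun i => by
    have := hquad 1 i
    rw [one_mulVec, Matrix.mul_one, hBB] at this
    rw [this]
    exact hfeas _ ⟨i, rfl⟩
  refine ⟨hball, ?_⟩
  obtain ⟨u, hu0, hu1, hu2⟩ := exists_weights_of_det_le_one hn (fun i => (B * P).col i) hball (by
    intro M hM hMy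
    have hBM : (B * M * B).PosDef := by
      have := hM.conjTranspose_mul_mul_same (B := B)
        (mulVec_injective_iff_isUnit.2 ((isUnit_iff_isUnit_det _).2 hBdet))
      rwa [conjTranspose_eq_transpose_of_trivial, hBT] at this
    have h1 := hopt (B * M * B) ⟨hBM, by
      rintro _ ⟨i, rfl⟩
      rw [← hquad]
      exact hMy i⟩
    have h2 := (Real.log_le_log_iff hBM.det_pos hpos.det_pos).1 (neg_le_neg_iff.1 h1)
    have h3 : (B * M * B).det = L.det * M.det := by
      rw [← hBB, det_mul, det_mul, det_mul]; ring
    rw [h3] at h2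
    exact le_of_mul_le_mul_left (by rwa [mul_one]) hpos.det_pos)
  refine ⟨u, hu0, hu1, fun v => ?_⟩
  have h1 := congrArg (fun M => v ⬝ᵥ M *ᵥ v) hu2
  simp only [one_mulVec, sum_mulVec, dotProduct_sum, smul_mulVec, dotProduct_smul, smul_eq_mul,
    vecMulVec_mulVec] at h1
  rw [← h1]
  refine Finset.sum_congr rfl fun i _ => ?_
  congr 1
  simp only [op_smul_eq_smul, smul_eq_mul]
  rw [dotProduct_comm v, sq]

/-! ### Existence of the optimal ellipsoid -/

/-- The form is tested on e_j ± e_k. -/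
theorem PosSemidef.abs_apply_le {n : ℕ} {X : Matrix (Fin n) (Fin n) ℝ} (hX : X.PosSemidef)
    (hd : ∀ j, X j j ≤ 1) (j k : Fin n) : |X j k| ≤ 1 := by
  have hq : ∀ s : ℝ, 0 ≤ X j j + s * X k j + s * (X j k + s * X k k) := by
    intro s
    have := hX.dotProduct_mulVec_nonneg (Pi.single j 1 + s • Pi.single k 1)
    rw [star_trivial] at this
    simpa [mulVec_add, mulVec_smul, add_dotProduct, dotProduct_add, mulVec_single,
      smul_dotProduct] using this
  have hsym : X k j = X j k := by
    have := congrFun (congrFun hX.isHermitian j) k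
    rwa [conjTranspose_apply, star_trivial] at this
  have h1 := hq 1
  have h2 := hq (-1)
  have h3 := hd j
  have h4 := hd k
  rw [abs_le]
  constructor <;> linarith

/-- Relaxed to semidefinite L, the feasible set is compact: in the basis H of columns of P, HᵀLH has
diagonal at most 1 and hence bounded entries. A small multiple of the identity is feasible, so the
maximal determinant is positive and the maximiser definite. -/
theorem exists_mveeOptimal {n m : ℕ} (P : Matrix (Fin n) (Fin m) ℝ) (e : Fin n → Fin m)
    (he : IsUnit (P.submatrix id e).det) : ∃ L, MVEEOptimal (Set.range P.col) L := by
  set H := P.submatrix id e with hH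
  set C : Set (Matrix (Fin n) (Fin n) ℝ) :=
    {L | L.PosSemidef ∧ ∀ i, P.col i ⬝ᵥ L *ᵥ P.col i ≤ 1} with hC
  have hclosed : IsClosed C := by
    have h1 : C = {L | Lᵀ = L} ∩ (⋂ x, {L | 0 ≤ x ⬝ᵥ L *ᵥ x}) ∩
        ⋂ i, {L | P.col i ⬝ᵥ L *ᵥ P.col i ≤ 1} := by
      ext L
      simp only [hC, Set.mem_ofPred_eq, posSemidef_iff_dotProduct_mulVec, star_trivial, IsHermitian,
        conjTranspose_eq_transpose_of_trivial, Set.mem_inter_iff, Set.mem_iInter]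
    have hcont : ∀ x : Fin n → ℝ, Continuous fun L : Matrix (Fin n) (Fin n) ℝ => x ⬝ᵥ L *ᵥ x :=
      fun x => continuous_const.dotProduct (continuous_id.matrix_mulVec continuous_const)
    rw [h1]
    exact ((isClosed_eq continuous_id.matrix_transpose continuous_id).inter
      (isClosed_iInter fun x => isClosed_le continuous_const (hcont x))).inter
      (isClosed_iInter fun i => isClosed_le (hcont _) continuous_const)
  have hbox : IsCompact (Set.univ.pi fun _ => Set.univ.pi fun _ => Set.Icc (-1) 1 :
      Set (Matrix (Fin n) (Fin n) ℝ)) :=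
    isCompact_univ_pi fun _ => isCompact_univ_pi fun _ => isCompact_Icc
  have hcomp : IsCompact C := by
    refine (hbox.image (f := fun X : Matrix (Fin n) (Fin n) ℝ => (H⁻¹)ᵀ * X * H⁻¹)
      (by fun_prop)).of_isClosed_subset hclosed ?_
    rintro L ⟨hL, hLP⟩
    refine ⟨Hᵀ * L * H, fun j _ k _ => ?_, ?_⟩
    · have hX : (Hᵀ * L * H).PosSemidef := by
        have := hL.conjTranspose_mul_mul_same H
        rwa [conjTranspose_eq_transpose_of_trivial] at this
      refine abs_le.1 (PosSemidef.abs_apply_le hX (fun j => ?_) j k)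
      refine le_trans (le_of_eq ?_) (hLP (e j))
      rw [Matrix.mul_assoc, mul_apply, dotProduct]
      rfl
    · have h1 : H * H⁻¹ = 1 := mul_nonsing_inv _ he
      have h2 : (H⁻¹)ᵀ * Hᵀ = 1 := by rw [← transpose_mul, h1, transpose_one]
      calc (H⁻¹)ᵀ * (Hᵀ * L * H) * H⁻¹ = ((H⁻¹)ᵀ * Hᵀ) * L * (H * H⁻¹) := by
            simp only [Matrix.mul_assoc]
        _ = L := by rw [h1, h2, Matrix.one_mul, Matrix.mul_one]
  set c : ℝ := (1 + ∑ i, P.col i ⬝ᵥ P.col i)⁻¹ with hc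
  have hnn : ∀ x : Fin n → ℝ, 0 ≤ x ⬝ᵥ x := fun x => Finset.sum_nonneg fun _ _ => mul_self_nonneg _
  have hs : 0 ≤ ∑ i, P.col i ⬝ᵥ P.col i := Finset.sum_nonneg fun i _ => hnn _
  have hc0 : 0 < c := by positivity
  have hstart : (c • (1 : Matrix (Fin n) (Fin n) ℝ)).PosDef := PosDef.one.smul hc0
  have hstartC : c • (1 : Matrix (Fin n) (Fin n) ℝ) ∈ C := by
    refine ⟨hstart.posSemidef, fun i => ?_⟩
    rw [smul_mulVec, one_mulVec, dotProduct_smul, smul_eq_mul, hc, inv_mul_eq_div,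
      div_le_one (by positivity)]
    have := Finset.single_le_sum (f := fun i => P.col i ⬝ᵥ P.col i) (fun i _ => hnn _)
      (Finset.mem_univ i)
    linarith
  obtain ⟨L, hLC, hLmax⟩ := hcomp.exists_isMaxOn ⟨_, hstartC⟩
    (continuous_id.matrix_det (n := Fin n) (R := ℝ)).continuousOn
  have hdet : 0 < L.det := hstart.det_pos.trans_le (hLmax hstartC)
  have hLpos : L.PosDef := hLC.1.posDef_iff_det_ne_zero.2 hdet.ne'
  refine ⟨L, ⟨hLpos, by rintro _ ⟨i, rfl⟩; exact hLC.2 i⟩, fun L' hL' => ?_⟩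
  refine neg_le_neg (Real.log_le_log hL'.1.det_pos (hLmax ⟨hL'.1.posSemidef, fun i => ?_⟩))
  exact hL'.2 _ ⟨i, rfl⟩

end

end PrecondSPA

/-! ### Singular values and the truncated decomposition under perturbation. -/

namespace PrecondSPA

noncomputable section

open Matrix

/-! ### Euclidean norms of vectors and matrices -/

section VecNorm

variable {d m r : ℕ}

theorem vecNorm2_nonneg (x : Fin d → ℝ) : 0 ≤ vecNorm2 x := norm_nonneg _

theorem sq_vecNorm2 (x : Fin d → ℝ) : vecNorm2 x ^ 2 = x ⬝ᵥ x := by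
  rw [vecNorm2, ← real_inner_self_eq_norm_sq, EuclideanSpace.inner_toLp_toLp]
  rfl

theorem vecNorm2_eq_sqrt (x : Fin d → ℝ) : vecNorm2 x = √(∑ j, x j ^ 2) := by
  rw [← Real.sqrt_sq (vecNorm2_nonneg x), sq_vecNorm2]
  simp only [dotProduct, sq]

theorem vecNorm2_le_of_dot_le {x : Fin d → ℝ} {y : Fin m → ℝ} {c : ℝ} (hc : 0 ≤ c)
    (h : x ⬝ᵥ x ≤ c ^ 2 * (y ⬝ᵥ y)) : vecNorm2 x ≤ c * vecNorm2 y := by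
  refine le_of_sq_le_sq ?_ (mul_nonneg hc (vecNorm2_nonneg y))
  rwa [mul_pow, sq_vecNorm2, sq_vecNorm2]

theorem vecNorm2_add_le (x y : Fin d → ℝ) : vecNorm2 (x + y) ≤ vecNorm2 x + vecNorm2 y := by
  rw [vecNorm2, WithLp.toLp_add]
  exact norm_add_le _ _

theorem vecNorm2_sub_le (x y : Fin d → ℝ) : vecNorm2 (x - y) ≤ vecNorm2 x + vecNorm2 y := by
  rw [vecNorm2, WithLp.toLp_sub]
  exact norm_sub_le _ _

theorem vecNorm2_mulVec_le (N : Matrix (Fin d) (Fin m) ℝ) (x : Fin m → ℝ) :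
    vecNorm2 (N *ᵥ x) ≤ norm2 N * vecNorm2 x :=
  (LinearMap.toContinuousLinearMap (Matrix.toEuclideanLin N)).le_opNorm (WithLp.toLp 2 x)

theorem dotProduct_mulVec_self (M : Matrix (Fin d) (Fin m) ℝ) (x : Fin m → ℝ) :
    M *ᵥ x ⬝ᵥ M *ᵥ x = x ⬝ᵥ (Mᵀ * M) *ᵥ x := by
  rw [← mulVec_mulVec, ← dotProduct_transpose_mulVec]

theorem vecNorm2_mulVec_of_orthonormal {M : Matrix (Fin d) (Fin m) ℝ} (hM : Mᵀ * M = 1)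
    (x : Fin m → ℝ) : vecNorm2 (M *ᵥ x) = vecNorm2 x := by
  rw [← abs_of_nonneg (vecNorm2_nonneg x), ← abs_of_nonneg (vecNorm2_nonneg (M *ᵥ x)),
    ← sq_eq_sq_iff_abs_eq_abs, sq_vecNorm2, sq_vecNorm2, dotProduct_mulVec_self, hM, one_mulVec]

theorem vecNorm2_transpose_mulVec_le {M : Matrix (Fin d) (Fin m) ℝ} {c : ℝ}
    (hc : 0 ≤ c) (hM : ∀ x, vecNorm2 (M *ᵥ x) ≤ c * vecNorm2 x) (x : Fin d → ℝ) :
    vecNorm2 (Mᵀ *ᵥ x) ≤ c * vecNorm2 x := by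
  have h1 : vecNorm2 (Mᵀ *ᵥ x) ^ 2 = ⟪WithLp.toLp 2 x, WithLp.toLp 2 (M *ᵥ Mᵀ *ᵥ x)⟫_ℝ := by
    rw [sq_vecNorm2, EuclideanSpace.inner_toLp_toLp, star_trivial, dotProduct_mulVec,
      ← mulVec_transpose, transpose_transpose]
  have h2 := real_inner_le_norm (WithLp.toLp 2 x : EuclideanSpace ℝ (Fin d))
    (WithLp.toLp 2 (M *ᵥ Mᵀ *ᵥ x))
  have h3 : ‖(WithLp.toLp 2 (M *ᵥ Mᵀ *ᵥ x) : EuclideanSpace ℝ (Fin d))‖ ≤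
    c * vecNorm2 (Mᵀ *ᵥ x) := hM _
  rw [← h1, ← vecNorm2] at h2
  rcases (vecNorm2_nonneg (Mᵀ *ᵥ x)).eq_or_lt with h0 | h0
  · rw [← h0]
    exact mul_nonneg hc (vecNorm2_nonneg x)
  · have h4 := mul_le_mul_of_nonneg_left h3 (vecNorm2_nonneg x)
    have h5 : vecNorm2 (Mᵀ *ᵥ x) * vecNorm2 (Mᵀ *ᵥ x)
        ≤ vecNorm2 (Mᵀ *ᵥ x) * (c * vecNorm2 x) := by nlinarith
    exact le_of_mul_le_mul_left h5 h0

theorem vecNorm2_transpose_mulVec_of_orthonormal {M : Matrix (Fin d) (Fin m) ℝ} (hM : Mᵀ * M = 1)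
    (x : Fin d → ℝ) : vecNorm2 (Mᵀ *ᵥ x) ≤ vecNorm2 x := by
  have := vecNorm2_transpose_mulVec_le (M := M) (c := 1) zero_le_one (fun x => by
    rw [vecNorm2_mulVec_of_orthonormal hM, one_mul]) x
  rwa [one_mul] at this

end VecNorm

/-! ### Singular values -/

theorem norm_sq_eq_sum_sq_repr {E : Type*} [NormedAddCommGroup E] [InnerProductSpace ℝ E]
    {n : ℕ} (b : OrthonormalBasis (Fin n) ℝ E) (x : E) :
    ‖x‖ ^ 2 = ∑ i, b.repr x i ^ 2 := by
  rw [← b.repr.norm_map x, EuclideanSpace.real_norm_sq_eq]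

section SingularValues

variable {E F : Type*} [NormedAddCommGroup E] [InnerProductSpace ℝ E] [FiniteDimensional ℝ E]
  [NormedAddCommGroup F] [InnerProductSpace ℝ F] [FiniteDimensional ℝ F]

theorem inner_map_eigenvectorBasis (T : E →ₗ[ℝ] F) {n : ℕ} (hn : Module.finrank ℝ E = n)
    (i j : Fin n) :
    ⟪T (T.isSymmetric_adjoint_comp_self.eigenvectorBasis hn i),
      T (T.isSymmetric_adjoint_comp_self.eigenvectorBasis hn j)⟫_ℝ =
      if i = j then T.singularValues i ^ 2 else 0 := by
  rw [← LinearMap.adjoint_inner_left, ← LinearMap.comp_apply,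
    LinearMap.IsSymmetric.apply_eigenvectorBasis, T.sq_singularValues_fin hn]
  simp only [RCLike.ofReal_real_eq_id, id_eq, real_inner_smul_left]
  rw [orthonormal_iff_ite.1 (OrthonormalBasis.orthonormal _)]
  simp

theorem norm_sq_map_eq_sum (T : E →ₗ[ℝ] F) {n : ℕ} (hn : Module.finrank ℝ E = n) (x : E) :
    ‖T x‖ ^ 2 = ∑ i : Fin n, T.singularValues i ^ 2 *
      (T.isSymmetric_adjoint_comp_self.eigenvectorBasis hn).repr x i ^ 2 := by
  set b := T.isSymmetric_adjoint_comp_self.eigenvectorBasis hn with hb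
  have h1 : T x = ∑ i, b.repr x i • T (b i) := by
    conv_lhs => rw [← b.sum_repr x]
    simp
  rw [h1, ← real_inner_self_eq_norm_sq, sum_inner]
  refine Finset.sum_congr rfl fun i _ => ?_
  simp only [inner_sum, real_inner_smul_left, real_inner_smul_right, hb,
    inner_map_eigenvectorBasis, mul_ite, mul_zero, Finset.sum_ite_eq, Finset.mem_univ, if_true]
  ring

theorem norm_map_le_singularValues_zero (T : E →ₗ[ℝ] F) (x : E) :
    ‖T x‖ ≤ T.singularValues 0 * ‖x‖ := by
  refine le_of_sq_le_sq ?_ (mul_nonneg (T.singularValues_nonneg 0) (norm_nonneg _))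
  rw [norm_sq_map_eq_sum T rfl, mul_pow,
    norm_sq_eq_sum_sq_repr (T.isSymmetric_adjoint_comp_self.eigenvectorBasis rfl) x,
    Finset.mul_sum]
  refine Finset.sum_le_sum fun i _ => ?_
  exact mul_le_mul_of_nonneg_right (pow_le_pow_left₀ (T.singularValues_nonneg _)
    (T.singularValues_antitone (Nat.zero_le _)) 2) (sq_nonneg _)

theorem singularValues_last_mul_norm_le (T : E →ₗ[ℝ] F) (x : E) :
    T.singularValues (Module.finrank ℝ E - 1) * ‖x‖ ≤ ‖T x‖ := by
  refine le_of_sq_le_sq ?_ (norm_nonneg _)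
  rw [norm_sq_map_eq_sum T rfl, mul_pow,
    norm_sq_eq_sum_sq_repr (T.isSymmetric_adjoint_comp_self.eigenvectorBasis rfl) x,
    Finset.mul_sum]
  refine Finset.sum_le_sum fun i _ => ?_
  exact mul_le_mul_of_nonneg_right (pow_le_pow_left₀ (T.singularValues_nonneg _)
    (T.singularValues_antitone (by omega)) 2) (sq_nonneg _)

end SingularValues

section Sigma

variable {d r : ℕ} {F : Matrix (Fin d) (Fin r) ℝ}

theorem le_of_rank_eq (hF : F.rank = r) : r ≤ d := by
  have := F.rank_le_height
  omega

theorem vecNorm2_mulVec_le_sigmaMax (F : Matrix (Fin d) (Fin r) ℝ) (x : Fin r → ℝ) :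
    vecNorm2 (F *ᵥ x) ≤ sigmaMax F * vecNorm2 x :=
  norm_map_le_singularValues_zero (Matrix.toEuclideanLin F) (WithLp.toLp 2 x)

theorem sigmaMin_mul_le_vecNorm2_mulVec (hF : F.rank = r) (x : Fin r → ℝ) :
    sigmaMin F * vecNorm2 x ≤ vecNorm2 (F *ᵥ x) := by
  have h := singularValues_last_mul_norm_le (Matrix.toEuclideanLin F) (WithLp.toLp 2 x)
  have e : min d r = r := min_eq_right (le_of_rank_eq hF)
  rw [finrank_euclideanSpace_fin] at h
  rw [sigmaMin, e]
  exact h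

/-- The zero-based index `min d r - 1` equals `r - 1`, which lies below the rank only for positive
`r`, the subtraction being truncated. -/
theorem sigmaMin_pos (hr : 0 < r) (hF : F.rank = r) : 0 < sigmaMin F := by
  have h := F.rank_eq_finrank_range_toLin (EuclideanSpace.basisFun (Fin d) ℝ).toBasis
    (EuclideanSpace.basisFun (Fin r) ℝ).toBasis
  rw [← toEuclideanLin_eq_toLin_orthonormal, hF] at h
  rw [sigmaMin, LinearMap.singularValues_pos_iff_lt_finrank_range, ← h]
  omega

end Sigma

/-! ### Singular value decompositions -/

section SVD

variable {d m r : ℕ}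

theorem mem_orthogonalGroup_of_orthonormalBasis {n : ℕ}
    (b : OrthonormalBasis (Fin n) ℝ (EuclideanSpace ℝ (Fin n))) :
    (of fun i k => b k i : Matrix (Fin n) (Fin n) ℝ) ∈ orthogonalGroup (Fin n) ℝ := by
  rw [mem_orthogonalGroup_iff']
  ext k l
  have h := orthonormal_iff_ite.1 b.orthonormal k l
  rw [one_apply, ← h, mul_apply, PiLp.inner_apply]
  refine Finset.sum_congr rfl fun i _ => ?_
  simp [mul_comm]

theorem mul_rectDiagonal_apply (U : Matrix (Fin d) (Fin d) ℝ) (σ : Fin (min d m) → ℝ) (i : Fin d)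
    (j : Fin m) : (U * rectDiagonal σ) i j =
      if h : (j : ℕ) < d then U i ⟨j, h⟩ * σ ⟨j, lt_min h j.isLt⟩ else 0 := by
  rw [mul_apply]
  split_ifs with h
  · rw [Finset.sum_eq_single ⟨j, h⟩]
    · simp [rectDiagonal]
    · intro k _ hk
      have : (k : ℕ) ≠ j := fun e => hk (Fin.ext e)
      simp [rectDiagonal, this]
    · simp
  · refine Finset.sum_eq_zero fun k _ => ?_
    have : (k : ℕ) ≠ j := fun e => h (e ▸ k.isLt)
    simp [rectDiagonal, this]

/-- V is an eigenbasis of AᵀA. The normalised images of those basis vectors with positive singular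
value are orthonormal, and any completion to a basis serves as U. -/
theorem exists_isSVD (A : Matrix (Fin d) (Fin m) ℝ) : ∃ U σ V, IsSVD A U σ V := by
  set T := toEuclideanLin A with hT
  have hm : Module.finrank ℝ (EuclideanSpace ℝ (Fin m)) = m := finrank_euclideanSpace_fin
  have hd : Module.finrank ℝ (EuclideanSpace ℝ (Fin d)) = d := finrank_euclideanSpace_fin
  set b := T.isSymmetric_adjoint_comp_self.eigenvectorBasis hm with hb
  set s := T.singularValues with hs
  have hpos : ∀ k, 0 < s k → k < d ∧ k < m := by
    intro k hk
    have h1 := T.singularValues_pos_iff_lt_finrank_range.1 hk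
    have h2 := Submodule.finrank_le T.range
    have h3 := T.finrank_range_le
    omega
  have hin : ∀ i j : Fin m, ⟪T (b i), T (b j)⟫_ℝ = if i = j then s i ^ 2 else 0 :=
    inner_map_eigenvectorBasis T hm
  let c₀ : Fin d → EuclideanSpace ℝ (Fin d) := fun k =>
    if h : (k : ℕ) < m then (s k)⁻¹ • T (b ⟨k, h⟩) else 0
  have hc₀ : Orthonormal ℝ (Set.domRestrict {k : Fin d | 0 < s k} c₀) := by
    rw [orthonormal_iff_ite]
    rintro ⟨k, hk⟩ ⟨l, hl⟩
    have hk' := (hpos _ hk).2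
    have hl' := (hpos _ hl).2
    have hk0 : s k ≠ 0 := ne_of_gt hk
    change ⟪c₀ k, c₀ l⟫_ℝ = _
    simp only [c₀, hk', hl', dif_pos, real_inner_smul_left,
      real_inner_smul_right, hin, Fin.mk.injEq, Subtype.mk.injEq, Fin.val_inj]
    split_ifs with h
    · subst h
      field_simp
    · simp
  obtain ⟨c, hc⟩ := hc₀.exists_orthonormalBasis_extension_of_card_eq (by rw [hd, Fintype.card_fin])
  have hTb : ∀ (j : Fin m) (i : Fin d), T (b j) i =
      if h : (j : ℕ) < d then c ⟨j, h⟩ i * s j else 0 := by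
    intro j i
    by_cases hsj : 0 < s j
    · have hjd := (hpos _ hsj).1
      have h1 : c ⟨j, hjd⟩ = (s j)⁻¹ • T (b j) := by
        rw [hc ⟨j, hjd⟩ hsj]
        simp [c₀]
      rw [dif_pos hjd, h1, PiLp.smul_apply, smul_eq_mul]
      field_simp
    · have h0 : s j = 0 := le_antisymm (not_lt.1 hsj) (T.singularValues_nonneg _)
      have h1 : T (b j) = 0 := by
        have := hin j j
        rw [if_pos rfl, h0, zero_pow two_ne_zero] at this
        exact inner_self_eq_zero.1 this
      rw [h1, h0]
      simp
  refine ⟨of fun i k => c k i, fun k => s k, of fun i k => b k i,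
    mem_orthogonalGroup_of_orthonormalBasis c, mem_orthogonalGroup_of_orthonormalBasis b,
    fun k => T.singularValues_nonneg _, fun k l hkl => T.singularValues_antitone hkl, ?_⟩
  set V : Matrix (Fin m) (Fin m) ℝ := of fun i k => b k i with hV
  have hVV : V * Vᵀ = 1 :=
     (mem_orthogonalGroup_iff _ _).1 (mem_orthogonalGroup_of_orthonormalBasis b)
  have hAV : A * V = (of fun i k => c k i : Matrix (Fin d) (Fin d) ℝ) *
      rectDiagonal (fun k : Fin (min d m) => s k) := by
    ext i j
    rw [mul_rectDiagonal_apply]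
    exact hTb j i
  rw [← hAV, Matrix.mul_assoc, hVV, Matrix.mul_one]

theorem exists_isTruncatedSVD (A : Matrix (Fin d) (Fin m) ℝ) (hr : r ≤ min d m) :
    ∃ P : Matrix (Fin r) (Fin m) ℝ, IsTruncatedSVD A r P := by
  obtain ⟨U, σ, V, h⟩ := exists_isSVD A
  exact ⟨_, U, σ, V, hr, h, rfl⟩

theorem rectDiagonal_mulVec_apply (σ : Fin (min d m) → ℝ) (ξ : Fin m → ℝ) (k : Fin d) :
    (rectDiagonal σ *ᵥ ξ) k =
      if h : (k : ℕ) < m then σ ⟨k, lt_min k.isLt h⟩ * ξ ⟨k, h⟩ else 0 := by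
  rw [mulVec, dotProduct]
  split_ifs with h
  · rw [Finset.sum_eq_single ⟨k, h⟩]
    · simp [rectDiagonal]
    · intro j _ hj
      have : (k : ℕ) ≠ j := fun e => hj (Fin.ext e.symm)
      simp [rectDiagonal, this]
    · simp
  · refine Finset.sum_eq_zero fun j _ => ?_
    have : (k : ℕ) ≠ j := fun e => h (e ▸ j.isLt)
    simp [rectDiagonal, this]

theorem sum_dite_val_eq (g : ℕ → ℝ) : ∑ k : Fin d, (if (k : ℕ) < m then g k else 0) =
    ∑ j : Fin m, (if (j : ℕ) < d then g j else 0) := by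
  rw [Fin.sum_univ_eq_sum_range (fun k => if k < m then g k else 0),
    Fin.sum_univ_eq_sum_range (fun k => if k < d then g k else 0), ← Finset.sum_filter,
    ← Finset.sum_filter]
  congr 1
  ext k
  simp [and_comm]

theorem rectDiagonal_mulVec_dot (σ : Fin (min d m) → ℝ) (ξ : Fin m → ℝ) :
    rectDiagonal σ *ᵥ ξ ⬝ᵥ rectDiagonal σ *ᵥ ξ =
      ∑ j : Fin m, if h : (j : ℕ) < d then (σ ⟨j, lt_min h j.isLt⟩) ^ 2 * ξ j ^ 2 else 0 := by
  have h := sum_dite_val_eq (d := d) (m := m)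
    (fun k => if h : k < d ∧ k < m then (σ ⟨k, lt_min h.1 h.2⟩) ^ 2 * ξ ⟨k, h.2⟩ ^ 2 else 0)
  rw [dotProduct]
  refine Eq.trans (Finset.sum_congr rfl fun k _ => ?_) (h.trans (Finset.sum_congr rfl fun j _ => ?_))
  · rw [rectDiagonal_mulVec_apply]
    by_cases hk : (k : ℕ) < m
    · simp only [hk, dif_pos, if_pos, k.isLt, and_self]
      ring
    · simp [hk]
  · by_cases hj : (j : ℕ) < d
    · simp [hj]
    · simp [hj]

theorem IsSVD.transpose_mul_left {A : Matrix (Fin d) (Fin m) ℝ} {U σ V} (h : IsSVD A U σ V) :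
    Uᵀ * U = 1 := (mem_orthogonalGroup_iff' _ _).1 h.1

theorem IsSVD.transpose_mul_right {A : Matrix (Fin d) (Fin m) ℝ} {U σ V} (h : IsSVD A U σ V) :
    Vᵀ * V = 1 := (mem_orthogonalGroup_iff' _ _).1 h.2.1

theorem IsSVD.transpose_mul_right' {A : Matrix (Fin d) (Fin m) ℝ} {U σ V} (h : IsSVD A U σ V) :
    V * Vᵀ = 1 := mul_eq_one_comm.1 h.transpose_mul_right

theorem IsSVD.mulVec_eq {A : Matrix (Fin d) (Fin m) ℝ} {U σ V} (h : IsSVD A U σ V)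
    (x : Fin m → ℝ) : A *ᵥ x = U *ᵥ rectDiagonal σ *ᵥ Vᵀ *ᵥ x := by
  rw [h.2.2.2.2, mulVec_mulVec, mulVec_mulVec, Matrix.mul_assoc]

theorem transpose_mul_submatrix {n k : ℕ} {U : Matrix (Fin n) (Fin n) ℝ} (hU : Uᵀ * U = 1)
    (e : Fin k → Fin n) : (U.submatrix id e)ᵀ * U = (1 : Matrix (Fin n) (Fin n) ℝ).submatrix e id := by
  rw [← hU]
  rfl

theorem submatrix_orthonormal {n k : ℕ} {U : Matrix (Fin n) (Fin n) ℝ} (hU : Uᵀ * U = 1)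
    {e : Fin k → Fin n} (he : Function.Injective e) :
    (U.submatrix id e)ᵀ * U.submatrix id e = 1 := by
  rw [← submatrix_one e he, ← hU]
  rfl

/-- The singular values past the rank of the unperturbed matrix are bounded by the perturbation. -/
theorem IsSVD.singularValue_le {F : Matrix (Fin d) (Fin r) ℝ} {W : Matrix (Fin r) (Fin m) ℝ}
    {N : Matrix (Fin d) (Fin m) ℝ} {U σ V} (h : IsSVD (F * W + N) U σ V) (hr : r < min d m) :
    σ ⟨r, hr⟩ ≤ norm2 N := by
  have hrm : r + 1 ≤ m := by omega
  set e : Fin (r + 1) → Fin m := Fin.castLE hrm with he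
  set V₁ := V.submatrix id e with hV₁
  -- Among r + 1 leading right singular vectors some combination x ≠ 0 is killed by `W`. On it the
  -- matrix acts as `N`, yet stretches by at least the singular value of zero-based index `r`.
  obtain ⟨c, hc, hc0⟩ := (Submodule.ne_bot_iff _).1 (LinearMap.ker_ne_bot_of_finrank_lt
    (f := (W * V₁).mulVecLin) (by simp))
  rw [LinearMap.mem_ker, mulVecLin_apply] at hc
  set x := V₁ *ᵥ c with hx
  have hWx : W *ᵥ x = 0 := by rw [hx, mulVec_mulVec, hc]
  have hxn : vecNorm2 x = vecNorm2 c := vecNorm2_mulVec_of_orthonormal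
    (submatrix_orthonormal h.transpose_mul_right (Fin.castLE_injective hrm)) c
  have hx0 : 0 < vecNorm2 x := by
    rw [hxn]
    refine lt_of_le_of_ne (vecNorm2_nonneg _) fun h0 => hc0 ?_
    rw [← dotProduct_self_eq_zero, ← sq_vecNorm2, ← h0, zero_pow two_ne_zero]
  set ξ := Vᵀ *ᵥ x with hξ
  have hξn : ξ ⬝ᵥ ξ = x ⬝ᵥ x := by
    rw [hξ, dotProduct_mulVec_self, transpose_transpose, h.transpose_mul_right', one_mulVec]
  have hξ0 : ∀ j : Fin m, r < j → ξ j = 0 := by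
    intro j hj
    have h1 : ξ = (1 : Matrix (Fin m) (Fin m) ℝ).submatrix id e *ᵥ c := by
      rw [hξ, hx, mulVec_mulVec, ← h.transpose_mul_right]
      rfl
    rw [h1, mulVec, dotProduct]
    refine Finset.sum_eq_zero fun k _ => ?_
    have : j ≠ e k := fun e' => by
      have := congrArg Fin.val e'
      simp only [he, Fin.val_castLE] at this
      omega
    simp [this]
  have hAx : (F * W + N) *ᵥ x = U *ᵥ rectDiagonal σ *ᵥ ξ := h.mulVec_eq x
  have h1 : σ ⟨r, hr⟩ * vecNorm2 x ≤ vecNorm2 ((F * W + N) *ᵥ x) := by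
    rw [hAx, vecNorm2_mulVec_of_orthonormal h.transpose_mul_left]
    refine le_of_sq_le_sq ?_ (vecNorm2_nonneg _)
    rw [mul_pow, sq_vecNorm2, sq_vecNorm2, ← hξn, rectDiagonal_mulVec_dot, dotProduct,
      Finset.mul_sum]
    refine Finset.sum_le_sum fun j _ => ?_
    by_cases hj : r < j
    · rw [hξ0 j hj]
      simp
    · rw [dif_pos (by omega), ← sq]
      exact mul_le_mul_of_nonneg_right (pow_le_pow_left₀ (h.2.2.1 _)
        (h.2.2.2.1 (Fin.mk_le_mk.2 (not_lt.1 hj))) 2) (sq_nonneg _)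
  rw [add_mulVec, ← mulVec_mulVec, hWx, mulVec_zero, zero_add] at h1
  exact le_of_mul_le_mul_right (h1.trans (vecNorm2_mulVec_le N x)) hx0

theorem submatrix_mulVec_comp {n k : ℕ} (U : Matrix (Fin n) (Fin n) ℝ) (hk : k ≤ n)
    (ζ : Fin n → ℝ) : U.submatrix id (Fin.castLE hk) *ᵥ (ζ ∘ Fin.castLE hk) =
      U *ᵥ fun a => if (a : ℕ) < k then ζ a else 0 := by
  ext i
  rw [mulVec, mulVec, dotProduct, dotProduct]
  refine Fintype.sum_of_injective (Fin.castLE hk) (Fin.castLE_injective hk) _ _ (fun a ha => ?_)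
    fun a => ?_
  · have : ¬ (a : ℕ) < k := fun h => ha ⟨⟨a, h⟩, rfl⟩
    simp [this]
  · simp

/-- The truncated singular value decomposition is the coordinate form of an orthogonal projection
that moves the perturbed matrix by at most the size of the perturbation. -/
theorem IsTruncatedSVD.exists_projection {F : Matrix (Fin d) (Fin r) ℝ}
    {W : Matrix (Fin r) (Fin m) ℝ} {N : Matrix (Fin d) (Fin m) ℝ} {P : Matrix (Fin r) (Fin m) ℝ}
    (h : IsTruncatedSVD (F * W + N) r P) : ∃ R : Matrix (Fin d) (Fin r) ℝ, Rᵀ * R = 1 ∧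
      P = Rᵀ * (F * W + N) ∧ ∀ x, vecNorm2 ((F * W + N) *ᵥ x - R *ᵥ Rᵀ *ᵥ (F * W + N) *ᵥ x) ≤
        norm2 N * vecNorm2 x := by
  obtain ⟨U, σ, V, hr, hsvd, rfl⟩ := h
  have hrd : r ≤ d := hr.trans (min_le_left _ _)
  have hUU := hsvd.transpose_mul_left
  set R := U.submatrix id (Fin.castLE hrd) with hR
  have hRU : ∀ ζ : Fin d → ℝ, Rᵀ *ᵥ U *ᵥ ζ = ζ ∘ Fin.castLE hrd := fun ζ => by
    rw [mulVec_mulVec, transpose_mul_submatrix hUU]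
    ext a
    simp [mulVec, dotProduct, one_apply]
  refine ⟨R, submatrix_orthonormal hUU (Fin.castLE_injective hrd), ?_, fun x => ?_⟩
  · rw [hsvd.2.2.2.2, Matrix.mul_assoc, ← Matrix.mul_assoc Rᵀ, transpose_mul_submatrix hUU]
    ext a j
    rw [diagonal_mul, mul_apply, Finset.sum_eq_single (Fin.castLE hrd a)]
    · have h2 : (rectDiagonal σ * Vᵀ) (Fin.castLE hrd a) j
          = (rectDiagonal σ *ᵥ (fun k => V j k)) (Fin.castLE hrd a) := rfl
      have h3 : (Fin.castLE hrd a : ℕ) < m := a.isLt.trans_le (hr.trans (min_le_right _ _))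
      rw [h2, rectDiagonal_mulVec_apply, dif_pos h3, submatrix_apply, id_eq, one_apply_eq, one_mul]
      rfl
    · intro k _ hk
      simp [one_apply, hk.symm]
    · simp
  · set ξ := Vᵀ *ᵥ x with hξ
    have hAx : (F * W + N) *ᵥ x = U *ᵥ rectDiagonal σ *ᵥ ξ := hsvd.mulVec_eq x
    -- The residual is the tail of the decomposition, whose largest entry is bounded by
    -- `singularValue_le`.
    set σ' : Fin (min d m) → ℝ := fun k => if (k : ℕ) < r then 0 else σ k with hσ'
    have hres : (F * W + N) *ᵥ x - R *ᵥ Rᵀ *ᵥ (F * W + N) *ᵥ x = U *ᵥ rectDiagonal σ' *ᵥ ξ := by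
      rw [hAx, hRU, hR, submatrix_mulVec_comp, ← mulVec_sub]
      congr 1
      ext a
      rw [Pi.sub_apply, rectDiagonal_mulVec_apply, rectDiagonal_mulVec_apply]
      by_cases ha : (a : ℕ) < r <;> simp [hσ', ha]
    have hξn : vecNorm2 ξ = vecNorm2 x :=
      vecNorm2_mulVec_of_orthonormal (by rw [transpose_transpose, hsvd.transpose_mul_right']) x
    have hN : 0 ≤ norm2 N := norm_nonneg _
    rw [hres, vecNorm2_mulVec_of_orthonormal hUU, ← hξn]
    refine vecNorm2_le_of_dot_le hN ?_
    rw [rectDiagonal_mulVec_dot, dotProduct, Finset.mul_sum]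
    refine Finset.sum_le_sum fun j _ => ?_
    have hnn : 0 ≤ norm2 N ^ 2 * (ξ j * ξ j) := mul_nonneg (sq_nonneg _) (mul_self_nonneg _)
    split_ifs with hjd
    · rw [← sq (ξ j)] at hnn ⊢
      refine mul_le_mul_of_nonneg_right ?_ (sq_nonneg _)
      by_cases hj : (j : ℕ) < r
      · simp only [hσ', hj, if_true, zero_pow two_ne_zero]
        exact sq_nonneg _
      · simp only [hσ', hj, if_false]
        have hrm : r < min d m := by omega
        exact pow_le_pow_left₀ (hsvd.2.2.1 _) ((hsvd.2.2.2.1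
          (Fin.mk_le_mk.2 (not_lt.1 hj))).trans (hsvd.singularValue_le hrm)) 2
    · exact hnn

end SVD

end

end PrecondSPA

/-! ### From the separable matrix to the preconditioned simplex and back. -/

namespace PrecondSPA

noncomputable section

open Matrix

/-! ### The coefficient matrix of a separable matrix -/

/-- The columns of `W` are nonnegative with sums at most one, and its column `τ j` is the `j`-th
unit vector. -/
structure IsVertexWeights {r m : ℕ} (W : Matrix (Fin r) (Fin m) ℝ) (τ : Fin r → Fin m) : Prop where
  nonneg : ∀ j i, 0 ≤ W j i
  sum_le : ∀ i, ∑ j, W j i ≤ 1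
  injective : Function.Injective τ
  col_eq : ∀ j, W.col (τ j) = Pi.single j 1

theorem IsSeparable.exists_weights {d m r : ℕ} {A : Matrix (Fin d) (Fin m) ℝ}
    {F : Matrix (Fin d) (Fin r) ℝ} (h : IsSeparable A F) :
    F.rank = r ∧ ∃ (W : Matrix (Fin r) (Fin m) ℝ) (τ : Fin r → Fin m),
      IsVertexWeights W τ ∧ A = F * W := by
  obtain ⟨hrm, K, π, rfl, hK, hF, hsum⟩ := h
  set e : Fin r ⊕ Fin (m - r) ≃ Fin m :=
    finSumFinEquiv.trans (finCongr (Nat.add_sub_cancel' hrm)) with he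
  have hW : ∀ j i, (identityBeside hrm K * π.permMatrix ℝ) j i =
      fromCols (1 : Matrix (Fin r) (Fin r) ℝ) K j (e.symm (π.symm i)) := by
    intro j i
    rw [Equiv.Perm.permMatrix, PEquiv.mul_toMatrix_toPEquiv]
    rfl
  refine ⟨hF, _, fun j => π (e (Sum.inl j)), ⟨fun j i => ?_, fun i => ?_, ?_, fun j => ?_⟩, rfl⟩
  · rw [hW]
    rcases e.symm (π.symm i) with a | a
    · rw [fromCols_apply_inl, one_apply]
      split_ifs <;> norm_num
    · exact hK j a
  · simp only [hW]
    rcases e.symm (π.symm i) with a | a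
    · simp [one_apply]
    · exact hsum a
  · exact π.injective.comp (e.injective.comp Sum.inl_injective)
  · ext k
    rw [col_apply, hW]
    simp [one_apply, Pi.single_apply]

section Selector

variable {r m : ℕ}

/-- The matrix that embeds the vertex coordinates. -/
def selector (τ : Fin r → Fin m) : Matrix (Fin m) (Fin r) ℝ :=
  (1 : Matrix (Fin m) (Fin m) ℝ).submatrix id τ

theorem selector_orthonormal {τ : Fin r → Fin m} (hτ : Function.Injective τ) :
    (selector τ)ᵀ * selector τ = 1 :=
  submatrix_orthonormal (by rw [transpose_one, Matrix.one_mul]) hτ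

theorem mul_selector {n : ℕ} (M : Matrix (Fin n) (Fin m) ℝ) (τ : Fin r → Fin m) :
    M * selector τ = M.submatrix id τ := by
  ext i j
  simp [selector, mul_apply, one_apply]

theorem IsVertexWeights.mul_selector {W : Matrix (Fin r) (Fin m) ℝ} {τ : Fin r → Fin m}
    (h : IsVertexWeights W τ) : W * selector τ = 1 := by
  rw [PrecondSPA.mul_selector]
  ext k j
  have := congrFun (h.col_eq j) k
  rw [col_apply, Pi.single_apply] at this
  rw [submatrix_apply, id_eq, this, one_apply]

end Selector

/-! ### Sums of squared entries -/

/-- Each row of QD is Dᵀ applied to a row of Q, and Dᵀ obeys the same operator bound as D. -/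
theorem sum_sq_mul_le {n m k : ℕ} (Q : Matrix (Fin k) (Fin n) ℝ) {D : Matrix (Fin n) (Fin m) ℝ}
    {η : ℝ} (hη : 0 ≤ η) (hD : ∀ x, vecNorm2 (D *ᵥ x) ≤ η * vecNorm2 x) :
    ∑ a, ∑ i, (Q * D) a i ^ 2 ≤ η ^ 2 * ∑ a, ∑ j, Q a j ^ 2 := by
  rw [Finset.mul_sum]
  refine Finset.sum_le_sum fun a _ => ?_
  have h1 := pow_le_pow_left₀ (vecNorm2_nonneg _) (vecNorm2_transpose_mulVec_le hη hD (Q a)) 2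
  rw [mul_pow, sq_vecNorm2, sq_vecNorm2, mulVec_transpose] at h1
  simp only [dotProduct, ← sq] at h1
  exact h1

theorem sum_sq_le_of_add {n k : ℕ} {Q Y : Matrix (Fin k) (Fin n) ℝ} {c δ : ℝ}
    (hX : ∑ a, ∑ j, (Q + Y) a j ^ 2 ≤ c) (hY : ∑ a, ∑ j, Y a j ^ 2 ≤ δ * ∑ a, ∑ j, Q a j ^ 2)
    (hδ : δ ≤ 1 / 1000000) : ∑ a, ∑ j, Q a j ^ 2 ≤ 1.101 * c := by
  have h1 : ∑ a, ∑ j, Q a j ^ 2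
      ≤ 1.1 * ∑ a, ∑ j, (Q + Y) a j ^ 2 + 11 * ∑ a, ∑ j, Y a j ^ 2 := by
    simp only [Finset.mul_sum, ← Finset.sum_add_distrib]
    refine Finset.sum_le_sum fun a _ => Finset.sum_le_sum fun j _ => ?_
    rw [Matrix.add_apply]
    -- The identity is 1.1(a+b)² + 11b² − a² = 0.1(a+11b)².
    nlinarith [sq_nonneg (Q a j + 11 * Y a j)]
  have h2 : 0 ≤ ∑ a, ∑ j, Q a j ^ 2 :=
    Finset.sum_nonneg fun _ _ => Finset.sum_nonneg fun _ _ => sq_nonneg _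
  nlinarith

/-! ### Preconditioned points form a noisy frame -/

theorem norm_colPoint {n m : ℕ} (A : Matrix (Fin n) (Fin m) ℝ) (i : Fin m) :
    ‖colPoint A i‖ = vecNorm2 (A.col i) := rfl

theorem sum_smul_colPoint {n m : ℕ} (A : Matrix (Fin n) (Fin m) ℝ) (z : Fin m → ℝ) :
    ∑ j, z j • colPoint A j = WithLp.toLp 2 (A *ᵥ z) := by
  ext a
  simp [colPoint, mulVec, dotProduct, mul_comm]

theorem norm_sum_smul_colPoint {n m : ℕ} (A : Matrix (Fin n) (Fin m) ℝ) (z : Fin m → ℝ) :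
    ‖∑ j, z j • colPoint A j‖ = vecNorm2 (A *ᵥ z) := by
  rw [sum_smul_colPoint]; rfl

theorem vecNorm2_single {n : ℕ} (j : Fin n) : vecNorm2 (Pi.single j 1 : Fin n → ℝ) = 1 := by
  rw [vecNorm2_eq_sqrt]
  simp [Pi.single_apply]

section Precondition

variable {r m : ℕ} {G : Matrix (Fin r) (Fin r) ℝ} {W N P : Matrix (Fin r) (Fin m) ℝ}
  {τ : Fin r → Fin m} {η : ℝ} {L : Matrix (Fin r) (Fin r) ℝ}

theorem colPoint_mul_eq (hP : P = G * W + N) (B : Matrix (Fin r) (Fin r) ℝ) (i : Fin m) :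
    colPoint (B * P) i = ∑ j, W j i • colPoint (B * G) j + colPoint (B * N) i := by
  rw [sum_smul_colPoint, hP, Matrix.mul_add, ← Matrix.mul_assoc]
  rfl

/-- The noise factors as BN = (BG)D with D = G⁻¹N of norm at most η. At the vertex indices BG
differs from r points of the unit ball only by (BG)D, so its squared Frobenius norm is at most 1.101
r, and the total noise is at most η√(1.101 r) < 1/1000. -/
theorem isNoisyFrame_of_mveeOptimal (hr : r ≠ 0) (hG : IsUnit G.det) (hη : 0 ≤ η)
    (hN : ∀ x, vecNorm2 ((G⁻¹ * N) *ᵥ x) ≤ η * vecNorm2 x) (hηr : η ^ 2 * r ≤ (1 / 1200) ^ 2)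
    (hW : IsVertexWeights W τ) (hP : P = G * W + N) (hL : MVEEOptimal (Set.range P.col) L) :
    ∃ u, IsNoisyFrame (colPoint (sqrtMatrix L hL.1.1 * G)) (colPoint (sqrtMatrix L hL.1.1 * P))
      (colPoint (sqrtMatrix L hL.1.1 * N)) (fun i j => W j i) u τ := by
  obtain ⟨hball, u, hu0, hu1, hu2⟩ := hL.exists_weights hr
  set B := sqrtMatrix L hL.1.1 with hB
  set D := G⁻¹ * N with hD
  have hBN : B * N = B * G * D := by
    rw [hD, Matrix.mul_assoc, ← Matrix.mul_assoc G, mul_nonsing_inv _ hG, Matrix.one_mul]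
  have hr1 : (1 : ℝ) ≤ r := by exact_mod_cast Nat.one_le_iff_ne_zero.2 hr
  have hη2 : η ^ 2 ≤ 1 / 1000000 := by nlinarith [sq_nonneg η]
  have hfro : ∑ a, ∑ j, (B * G) a j ^ 2 ≤ 1.101 * r := by
    refine sum_sq_le_of_add (Y := B * G * (D * selector τ)) (δ := η ^ 2) ?_
      (sum_sq_mul_le _ hη fun x => ?_) hη2
    · have h1 : B * G + B * G * (D * selector τ) = (B * P).submatrix id τ := by
        rw [← mul_selector, hP, Matrix.mul_add, Matrix.add_mul, ← Matrix.mul_assoc B G W,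
          Matrix.mul_assoc (B * G) W, hW.mul_selector, Matrix.mul_one, hBN,
          Matrix.mul_assoc (B * G)]
      rw [h1, Finset.sum_comm]
      calc ∑ j, ∑ a, ((B * P).submatrix id τ) a j ^ 2 ≤ ∑ _j : Fin r, (1 : ℝ) := by
            refine Finset.sum_le_sum fun j _ => ?_
            have := hball (τ j)
            simp only [dotProduct, ← sq] at this
            exact this
        _ = r := by simp
    · rw [← mulVec_mulVec]
      refine (hN _).trans (le_of_eq ?_)
      rw [vecNorm2_mulVec_of_orthonormal (selector_orthonormal hW.injective)]
  have hin : ∀ i (v : EuclideanSpace ℝ (Fin r)),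
      ⟪colPoint (B * P) i, v⟫_ℝ = (B * P).col i ⬝ᵥ v.ofLp := fun i v => by
    rw [real_inner_comm]
    exact (EuclideanSpace.inner_toLp_toLp _ _).trans (by rw [star_trivial])
  have hnorm : ∀ i, ‖colPoint (B * P) i‖ ^ 2 = (B * P).col i ⬝ᵥ (B * P).col i := fun i => by
    rw [norm_colPoint, sq_vecNorm2]
  refine ⟨u, fun i j => hW.nonneg j i, hW.sum_le, colPoint_mul_eq hP B, fun j => ?_, hW.injective,
    fun i => ?_, hu0, fun i hi => ?_, fun v => ?_, ?_⟩
  · rw [colPoint_mul_eq hP]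
    congr 1
    have : ∀ k, W k (τ j) = Pi.single (M := fun _ => ℝ) j 1 k := fun k => congrFun (hW.col_eq j) k
    simp [this, Pi.single_apply]
  · have := hball i
    rw [← hnorm] at this
    exact le_of_sq_le_sq (by rwa [one_pow]) zero_le_one
  · have := hu1 i hi
    rw [← hnorm] at this
    exact (pow_eq_one_iff_of_nonneg (norm_nonneg _) two_ne_zero).1 this
  · simp only [hin]
    rw [hu2]
    exact (sq_vecNorm2 v.ofLp).symm
  · have h1 : ∑ i, ‖colPoint (B * N) i‖ ^ 2 = ∑ a, ∑ i, (B * G * D) a i ^ 2 := by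
      rw [Finset.sum_comm, ← hBN]
      refine Finset.sum_congr rfl fun i _ => ?_
      rw [norm_colPoint, sq_vecNorm2]
      simp only [dotProduct, ← sq]
      rfl
    rw [h1]
    refine (sum_sq_mul_le _ hη hN).trans ?_
    nlinarith [sq_nonneg η]

/-- Once the frame bounds give BG norm at most 11/10, each noise vector BGD e_i is bounded by 1.1η,
without the factor √r of the Frobenius estimate. -/
theorem isNearSimplex_of_mveeOptimal (hr : r ≠ 0) (hG : IsUnit G.det) (hη : 0 ≤ η)
    (hN : ∀ x, vecNorm2 ((G⁻¹ * N) *ᵥ x) ≤ η * vecNorm2 x) (hηr : η ^ 2 * r ≤ (1 / 1200) ^ 2)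
    (hW : IsVertexWeights W τ) (hP : P = G * W + N) (hL : MVEEOptimal (Set.range P.col) L) :
    IsNearSimplex (colPoint (sqrtMatrix L hL.1.1 * G)) (colPoint (sqrtMatrix L hL.1.1 * P))
      (fun i j => W j i) τ (11 / 10 * η) := by
  obtain ⟨u, hu⟩ := isNoisyFrame_of_mveeOptimal hr hG hη hN hηr hW hP hL
  set B := sqrtMatrix L hL.1.1 with hB
  have hV : Module.finrank ℝ (EuclideanSpace ℝ (Fin r)) = Fintype.card (Fin r) := by simp
  have hup : ∀ z, vecNorm2 ((B * G) *ᵥ z) ≤ 11 / 10 * vecNorm2 z := fun z => by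
    rw [← norm_sum_smul_colPoint, vecNorm2_eq_sqrt]
    exact hu.norm_synthesis_le hV z
  have hnoise : ∀ i, ‖colPoint (B * N) i‖ ≤ 11 / 10 * η := fun i => by
    have h1 : (B * N).col i = (B * G) *ᵥ (G⁻¹ * N) *ᵥ Pi.single i 1 := by
      rw [mulVec_mulVec, Matrix.mul_assoc, ← Matrix.mul_assoc G, mul_nonsing_inv _ hG,
        Matrix.one_mul, mulVec_single_one]
    rw [norm_colPoint, h1]
    have h2 := hN (Pi.single i 1)
    rw [vecNorm2_single, mul_one] at h2
    exact (hup _).trans (mul_le_mul_of_nonneg_left h2 (by norm_num))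
  refine ⟨hu.weight_nonneg, hu.weight_sum, fun i => ?_, fun j => ?_, hu.le_norm_synthesis hV,
    fun j => ?_, ?_⟩
  · rw [hu.eq_comb i, add_sub_cancel_left]
    exact hnoise i
  · rw [hu.vertex j, add_sub_cancel_left]
    exact hnoise _
  · rw [norm_colPoint, ← mulVec_single_one]
    refine (hup _).trans ?_
    rw [vecNorm2_single, mul_one]
  · rw [Fintype.card_fin]
    have h1 : √(r : ℝ) * η ≤ 1 / 1200 := by
      refine le_of_sq_le_sq ?_ (by norm_num)
      rw [mul_pow, Real.sq_sqrt (Nat.cast_nonneg r)]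
      linarith
    linarith

end Precondition

/-! ### Reduction to the column space -/

theorem isUnit_det_of_lower_bound {n : ℕ} {G : Matrix (Fin n) (Fin n) ℝ} {s : ℝ} (hs : 0 < s)
    (hG : ∀ x, s * vecNorm2 x ≤ vecNorm2 (G *ᵥ x)) : IsUnit G.det := by
  rw [← isUnit_iff_isUnit_det, ← mulVec_injective_iff_isUnit]
  have h0 : ∀ x, G *ᵥ x = 0 → x = 0 := fun x hx => by
    have h1 := hG x
    rw [hx, vecNorm2_eq_sqrt (0 : Fin n → ℝ)] at h1
    simp only [Pi.zero_apply, zero_pow two_ne_zero, Finset.sum_const_zero, Real.sqrt_zero] at h1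
    have h2 : vecNorm2 x = 0 := le_antisymm (by nlinarith [vecNorm2_nonneg x]) (vecNorm2_nonneg x)
    rw [← dotProduct_self_eq_zero, ← sq_vecNorm2, h2, zero_pow two_ne_zero]
  intro x y hxy
  exact sub_eq_zero.1 (h0 _ (by rw [mulVec_sub]; exact sub_eq_zero.2 hxy))

section Reduction

variable {d m r : ℕ} {F : Matrix (Fin d) (Fin r) ℝ} {W : Matrix (Fin r) (Fin m) ℝ}
  {N : Matrix (Fin d) (Fin m) ℝ} {τ : Fin r → Fin m} {R : Matrix (Fin d) (Fin r) ℝ}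

/-- The vertices are close to the leading singular subspace. -/
theorem vecNorm2_sub_projection_le (hW : IsVertexWeights W τ) (hR : Rᵀ * R = 1)
    (hres : ∀ x, vecNorm2 ((F * W + N) *ᵥ x - R *ᵥ Rᵀ *ᵥ (F * W + N) *ᵥ x) ≤
      norm2 N * vecNorm2 x) (x : Fin r → ℝ) :
    vecNorm2 (F *ᵥ x - R *ᵥ Rᵀ *ᵥ F *ᵥ x) ≤ 3 * norm2 N * vecNorm2 x := by
  set x' := selector τ *ᵥ x with hx'
  have hx'n : vecNorm2 x' = vecNorm2 x :=
    vecNorm2_mulVec_of_orthonormal (selector_orthonormal hW.injective) x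
  have hWx : W *ᵥ x' = x := by rw [hx', mulVec_mulVec, hW.mul_selector, one_mulVec]
  have hFx : F *ᵥ x = (F * W + N) *ᵥ x' - N *ᵥ x' := by
    rw [add_mulVec, ← mulVec_mulVec, hWx, add_sub_cancel_right]
  -- The perturbed matrix contributes ε to the residual and the noise, bounded crudely, 2ε.
  have h1 : F *ᵥ x - R *ᵥ Rᵀ *ᵥ F *ᵥ x =
      ((F * W + N) *ᵥ x' - R *ᵥ Rᵀ *ᵥ (F * W + N) *ᵥ x') -
        (N *ᵥ x' - R *ᵥ Rᵀ *ᵥ N *ᵥ x') := by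
    rw [hFx, mulVec_sub, mulVec_sub]
    abel
  have h2 := vecNorm2_sub_le ((F * W + N) *ᵥ x' - R *ᵥ Rᵀ *ᵥ (F * W + N) *ᵥ x')
    (N *ᵥ x' - R *ᵥ Rᵀ *ᵥ N *ᵥ x')
  have h3 := vecNorm2_sub_le (N *ᵥ x') (R *ᵥ Rᵀ *ᵥ N *ᵥ x')
  have h4 := vecNorm2_transpose_mulVec_of_orthonormal hR (N *ᵥ x')
  rw [vecNorm2_mulVec_of_orthonormal hR] at h3
  have h5 := hres x'
  have h6 := vecNorm2_mulVec_le N x'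
  rw [hx'n] at h5 h6
  rw [h1]
  linarith

theorem le_vecNorm2_transpose_mul_mulVec (hF : F.rank = r) (hW : IsVertexWeights W τ)
    (hR : Rᵀ * R = 1)
    (hres : ∀ x, vecNorm2 ((F * W + N) *ᵥ x - R *ᵥ Rᵀ *ᵥ (F * W + N) *ᵥ x) ≤
      norm2 N * vecNorm2 x) (x : Fin r → ℝ) :
    (sigmaMin F - 3 * norm2 N) * vecNorm2 x ≤ vecNorm2 ((Rᵀ * F) *ᵥ x) := by
  have h1 := vecNorm2_sub_projection_le hW hR hres x
  have h2 := vecNorm2_add_le (F *ᵥ x - R *ᵥ Rᵀ *ᵥ F *ᵥ x) (R *ᵥ Rᵀ *ᵥ F *ᵥ x)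
  rw [sub_add_cancel, vecNorm2_mulVec_of_orthonormal hR] at h2
  have h3 := sigmaMin_mul_le_vecNorm2_mulVec hF x
  rw [← mulVec_mulVec]
  linarith

/-- The data that a run of the preconditioned algorithm works with after its first step: the
projection `R`, and a bound `η` on the noise relative to the projected vertices. -/
theorem exists_reduction (hr : 0 < r) (hF : F.rank = r) (hW : IsVertexWeights W τ)
    (hε : norm2 N ≤ sigmaMin F / (1225 * √(r : ℝ))) {P : Matrix (Fin r) (Fin m) ℝ}
    (hP : IsTruncatedSVD (F * W + N) r P) :
    ∃ (R : Matrix (Fin d) (Fin r) ℝ) (η : ℝ), Rᵀ * R = 1 ∧ P = Rᵀ * F * W + Rᵀ * N ∧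
      P = Rᵀ * (F * W + N) ∧
      (∀ x, vecNorm2 ((F * W + N) *ᵥ x - R *ᵥ Rᵀ *ᵥ (F * W + N) *ᵥ x) ≤ norm2 N * vecNorm2 x) ∧
      IsUnit (Rᵀ * F).det ∧ 0 ≤ η ∧ η * sigmaMin F ≤ 1.02 * norm2 N ∧
      η ^ 2 * r ≤ (1 / 1200) ^ 2 ∧
      (∀ x, vecNorm2 (((Rᵀ * F)⁻¹ * (Rᵀ * N)) *ᵥ x) ≤ η * vecNorm2 x) ∧
      IsUnit (P.submatrix id τ).det := by
  obtain ⟨R, hR, hPR, hres⟩ := hP.exists_projection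
  set ε := norm2 N with hεdef
  have hε0 : 0 ≤ ε := norm_nonneg _
  set σ := sigmaMin F with hσ
  have hσ0 : 0 < σ := sigmaMin_pos hr hF
  have hr1 : (1 : ℝ) ≤ √(r : ℝ) := by
    rw [Real.one_le_sqrt]
    exact_mod_cast hr
  have hεr : ε * (1225 * √(r : ℝ)) ≤ σ := (le_div_iff₀ (by positivity)).1 hε
  have hεσ : 1225 * ε ≤ σ := by nlinarith
  set s := σ - 3 * ε with hs
  have hsσ : 0.99 * σ ≤ s := by norm_num at *; linarith
  have hs0 : 0 < s := lt_of_lt_of_le (by positivity) hsσ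
  have hlow : ∀ x, s * vecNorm2 x ≤ vecNorm2 ((Rᵀ * F) *ᵥ x) :=
    le_vecNorm2_transpose_mul_mulVec hF hW hR hres
  have hG : IsUnit (Rᵀ * F).det := isUnit_det_of_lower_bound hs0 hlow
  have hPe : P = Rᵀ * F * W + Rᵀ * N := by rw [hPR, Matrix.mul_add, Matrix.mul_assoc]
  have hRN : ∀ x, vecNorm2 ((Rᵀ * N) *ᵥ x) ≤ ε * vecNorm2 x := fun x => by
    rw [← mulVec_mulVec]
    exact (vecNorm2_transpose_mulVec_of_orthonormal hR _).trans (vecNorm2_mulVec_le N x)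
  -- The gap between 1225 and 1200 pays for the 3ε: s ≥ (1225√r − 3)ε ≥ 1200√r ε.
  refine ⟨R, ε / s, hR, hPe, hPR, hres, hG, by positivity, ?_, ?_, fun x => ?_, ?_⟩
  · rw [div_mul_eq_mul_div, div_le_iff₀ hs0]
    nlinarith
  · have h1 : ε / s * √(r : ℝ) ≤ 1 / 1200 := by
      rw [div_mul_eq_mul_div, div_le_iff₀ hs0]
      linarith
    have h2 := pow_le_pow_left₀ (by positivity) h1 2
    rwa [mul_pow, Real.sq_sqrt (Nat.cast_nonneg r)] at h2
  · rw [div_mul_eq_mul_div, le_div_iff₀ hs0, mul_comm _ s]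
    refine (hlow _).trans ?_
    rw [mulVec_mulVec, ← Matrix.mul_assoc, mul_nonsing_inv _ hG, Matrix.one_mul]
    exact hRN x
  -- The vertex columns of `P` form RᵀF plus a perturbation of norm at most ε, hence are
  -- independent; this is what the existence of the ellipsoid needs.
  · refine isUnit_det_of_lower_bound (s := s - ε) (by linarith) fun x => ?_
    rw [← mul_selector, hPe, Matrix.add_mul, Matrix.mul_assoc _ W, hW.mul_selector, Matrix.mul_one,
      add_mulVec]
    have h1 := hlow x
    have h2 := hRN (selector τ *ᵥ x)
    rw [vecNorm2_mulVec_of_orthonormal (selector_orthonormal hW.injective), mulVec_mulVec] at h2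
    have h3 := vecNorm2_sub_le ((Rᵀ * F) *ᵥ x + (Rᵀ * N * selector τ) *ᵥ x)
      ((Rᵀ * N * selector τ) *ᵥ x)
    rw [add_sub_cancel_right] at h3
    linarith

/-- A bound for the preconditioned points yields one for the original columns. -/
theorem vecNorm2_col_sub_col_le (hr : 0 < r) (hF : F.rank = r) (hW : IsVertexWeights W τ)
    (hR : Rᵀ * R = 1)
    (hres : ∀ x, vecNorm2 ((F * W + N) *ᵥ x - R *ᵥ Rᵀ *ᵥ (F * W + N) *ᵥ x) ≤
      norm2 N * vecNorm2 x) (hG : IsUnit (Rᵀ * F).det) {η : ℝ}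
    (hη : η * sigmaMin F ≤ 1.02 * norm2 N) {B : Matrix (Fin r) (Fin r) ℝ}
    (hB : ∀ z, 22 / 25 * vecNorm2 z ≤ vecNorm2 ((B * (Rᵀ * F)) *ᵥ z)) {i : Fin m} {j : Fin r}
    (hij : ‖colPoint (B * (Rᵀ * (F * W + N))) i - colPoint (B * (Rᵀ * F)) j‖ ≤
      80 * (11 / 10 * η)) :
    vecNorm2 ((F * W + N).col i - F.col j) ≤ (432 * cond F + 4) * norm2 N := by
  set A := F * W + N with hA
  set t := A.col i - F.col j with ht
  have hσ0 : 0 < sigmaMin F := sigmaMin_pos hr hF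
  have hAi : A *ᵥ Pi.single i 1 = A.col i := mulVec_single_one A i
  have hFj : F *ᵥ Pi.single j 1 = F.col j := mulVec_single_one F j
  have h1 := hres (Pi.single i 1)
  have h2 := vecNorm2_sub_projection_le hW hR hres (Pi.single j 1)
  rw [hAi, vecNorm2_single, mul_one] at h1
  rw [hFj, vecNorm2_single, mul_one] at h2
  have h3 : vecNorm2 (t - R *ᵥ Rᵀ *ᵥ t) ≤ 4 * norm2 N := by
    have e : t - R *ᵥ Rᵀ *ᵥ t =
        (A.col i - R *ᵥ Rᵀ *ᵥ A.col i) - (F.col j - R *ᵥ Rᵀ *ᵥ F.col j) := by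
      rw [ht, mulVec_sub, mulVec_sub]; abel
    rw [e]
    refine (vecNorm2_sub_le _ _).trans ?_
    linarith
  -- In vertex coordinates the projected error has norm at most 88η/0.88 = 100η, and mapping back by
  -- `F` costs only σ_max(F).
  set x := (Rᵀ * F)⁻¹ *ᵥ Rᵀ *ᵥ t with hx
  have hGx : (Rᵀ * F) *ᵥ x = Rᵀ *ᵥ t := by
    rw [hx, mulVec_mulVec, mul_nonsing_inv _ hG, one_mulVec]
  have h4 : vecNorm2 x ≤ 100 * η := by
    have e : colPoint (B * (Rᵀ * A)) i - colPoint (B * (Rᵀ * F)) j =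
        WithLp.toLp 2 ((B * (Rᵀ * F)) *ᵥ x) := by
      rw [← mulVec_mulVec, hGx, ht, mulVec_sub, mulVec_sub, mulVec_mulVec, mulVec_mulVec,
        WithLp.toLp_sub]
      congr 1
      · rw [← Matrix.mul_assoc]; rfl
      · rw [← Matrix.mul_assoc]; rfl
    rw [e] at hij
    have := (hB x).trans hij
    linarith
  have h5 : vecNorm2 (Rᵀ *ᵥ t) ≤ 102 * cond F * norm2 N := by
    rw [← hGx, ← mulVec_mulVec]
    refine (vecNorm2_transpose_mulVec_of_orthonormal hR _).trans
      ((vecNorm2_mulVec_le_sigmaMax F x).trans ?_)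
    have hmax : 0 ≤ sigmaMax F := LinearMap.singularValues_nonneg _ _
    have h6 : η ≤ 1.02 * norm2 N / sigmaMin F := (le_div_iff₀ hσ0).2 hη
    calc sigmaMax F * vecNorm2 x ≤ sigmaMax F * (100 * (1.02 * norm2 N / sigmaMin F)) := by
          gcongr
          linarith
      _ = 102 * cond F * norm2 N := by
          rw [cond]
          ring
  have h7 := vecNorm2_add_le (t - R *ᵥ Rᵀ *ᵥ t) (R *ᵥ Rᵀ *ᵥ t)
  rw [sub_add_cancel, vecNorm2_mulVec_of_orthonormal hR] at h7
  have h8 : 0 ≤ cond F * norm2 N :=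
    mul_nonneg (div_nonneg (LinearMap.singularValues_nonneg _ _) hσ0.le) (norm_nonneg _)
  -- The bounds add up to (102κ(F) + 4)ε; the rest of 432 is slack.
  linarith

end Reduction

end

end PrecondSPA

open PrecondSPA

theorem mainTheorem1 {d m r : ℕ} (hr : 2 ≤ r)
    (A N : Matrix (Fin d) (Fin m) ℝ) (F : Matrix (Fin d) (Fin r) ℝ)
    (hA : PrecondSPA.IsSeparable A F)
    (ε : ℝ) (hN : PrecondSPA.norm2 N = ε)
    (hε : ε ≤ PrecondSPA.sigmaMin F / (1225 * √(r : ℝ))) :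
    PrecondSPA.Terminates (A + N) r ∧
    ∀ I : Finset (Fin m), PrecondSPA.Returns (A + N) r I →
      ∃ order : Fin r ≃ I, ∀ j : Fin r,
        PrecondSPA.vecNorm2 ((A + N).col (order j) - F.col j) ≤
          (432 * PrecondSPA.cond F + 4) * ε := by
  subst hN
  have hr0 : 0 < r := by omega
  have hrm : r ≤ m := hA.1
  obtain ⟨hF, W, τ, hW, rfl⟩ := hA.exists_weights
  have : Nonempty (Fin r) := ⟨⟨0, hr0⟩⟩
  refine ⟨⟨exists_isTruncatedSVD _ (le_min (le_of_rank_eq hF) hrm), fun P hP => ?_⟩, ?_⟩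
  · obtain ⟨R, η, -, hP1, -, -, hG, hη0, -, hηr, hηN, hPu⟩ := exists_reduction hr0 hF hW hε hP
    refine ⟨exists_mveeOptimal P τ hPu, fun L hL => ?_⟩
    have := spaTerminates_of_isNearSimplex
      (isNearSimplex_of_mveeOptimal hr0.ne' hG hη0 hηN hηr hW hP1 hL)
    rwa [Fintype.card_fin] at this
  · rintro I ⟨P, hP, L, hL, hI⟩
    obtain ⟨R, η, hR, hP1, hP2, hres, hG, hη0, hησ, hηr, hηN, -⟩ :=
      exists_reduction hr0 hF hW hε hP
    have hns := isNearSimplex_of_mveeOptimal hr0.ne' hG hη0 hηN hηr hW hP1 hL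
    obtain ⟨order, horder⟩ := exists_equiv_of_spaReturns hns (by rwa [Fintype.card_fin])
    refine ⟨order, fun j => vecNorm2_col_sub_col_le hr0 hF hW hR hres hG hησ
      (B := sqrtMatrix L hL.1.1) (fun z => ?_) (hP2 ▸ horder j)⟩
    rw [vecNorm2_eq_sqrt, ← norm_sum_smul_colPoint]
    exact hns.lower z
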